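/- **Theorem 2.4.** For a vector $v$ write $\hat v=v/\|v\|$ (Euclidean norm; $\hat 0=0$). For $A\in\mathbb R^{m\times n}$ with columns $a_1,\dots,a_n$ let $$\rho_A=\max_{y\in\operatorname{im}(A)\setminus\{0\}}\ \min_{1\le j\le n}\ \hat a_j^{\top}\hat y$$ be its Goffin measure. The *Full Support Kernel Algorithm* takes as input a matrix $\bar A\in\mathbb R^{m\times n}$ with $\|\bar a_j\|=1$ for all $j$ and $\rho_{\bar A}<0$. Let $\Pi$ be the orthogonal projection of $\mathbb R^n$ to $\ker \bar A$ and $\varepsilon=1/(11m)$. Initialize $A:=\bar A$, $x:=(1,\dots,1)$, $y:=Ax$. While $\Pi x$ is not a positive vector, choose $k\in\arg\min_{j}\hat a_j^{\top}\hat y$ (for the current $A$ and $y$), and * if $\hat a_k^{\top}\hat y<-\varepsilon$, perform a *DV (Dunagan–Vempala) update*: $x:=x-\frac{a_k^{\top}y}{\|a_k\|^2}e_k$, $\ y:=y-(\hat a_k^{\top}y)\,\hat a_k$; * otherwise, *rescale*: $A:=(I_m+\hat y\hat y^{\top})A$, $\ y:=2y$. When $\Pi x>0$, return $\bar x=\Pi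 x$. There is an absolute constant $C>0$ such that for all $m,n$ and every $\bar A\in\mathbb R^{m\times n}$ with unit-norm columns and $\rho=\rho_{\bar A}<0$: 1. every execution of the algorithm (for every way of breaking ties in the choice of $k$) terminates, its output $\bar x$ satisfies $\bar A\bar x=0$ and $\bar x>0$, and it performs at most $C\,(m^2\log n+m^3\log|\rho|^{-1})$ DV updates; 2. the algorithm (with ties broken by the smallest index) can be implemented, in exact real arithmetic with unit cost for each addition, subtraction, multiplication, division, comparison and loading of an integer constant, so that the whole computation of $\bar x$ uses at most $C\,\bigl(m^2n\log n+(m^3n+mn^2)\log|\rho|^{-1}\bigr)$ such operations. The implementation is uniform in $m,n$ and uses no square roots. -/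

import Mathlib

open scoped Matrix

noncomputable section

namespace KernelAlg

/-! ### Vectors, the Goffin measure, the projection to the kernel -/

/-- `ℝ^d` with the Euclidean norm and inner product. -/
abbrev Vec (d : ℕ) : Type := EuclideanSpace ℝ (Fin d)

/-- The normalization `v / ‖v‖`, with value `0` at `v = 0`. -/
def hat {d : ℕ} (v : Vec d) : Vec d := ‖v‖⁻¹ • v

/-- The `j`-th column of `A`. -/
def col {m n : ℕ} (A : Matrix (Fin m) (Fin n) ℝ) (j : Fin n) : Vec m :=
  WithLp.toLp 2 (fun i => A i j)

/-- The linear map `x ↦ A x`. -/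
def mulVecL {m n : ℕ} (A : Matrix (Fin m) (Fin n) ℝ) : Vec n →ₗ[ℝ] Vec m :=
  Matrix.toEuclideanLin A

/-- `cosAngle A y j` is the inner product of the normalized `j`-th column with `y / ‖y‖`. -/
def cosAngle {m n : ℕ} (A : Matrix (Fin m) (Fin n) ℝ) (y : Vec m) (j : Fin n) : ℝ :=
  inner ℝ (hat (col A j)) (hat y)

/-- Goffin's condition measure: the maximum over the nonzero `y` in the image of `A` of
`min_j cosAngle A y j`. -/
def goffin {m n : ℕ} (A : Matrix (Fin m) (Fin n) ℝ) : ℝ :=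
  sSup {t : ℝ | ∃ y ∈ LinearMap.range (mulVecL A), y ≠ 0 ∧ t = ⨅ j : Fin n, cosAngle A y j}

/-- The orthogonal projection of `x` to the kernel of `A`. -/
def kernelProj {m n : ℕ} (A : Matrix (Fin m) (Fin n) ℝ) (x : Vec n) : Vec n :=
  (LinearMap.ker (mulVecL A)).starProjection x

/-! ### The Full Support Kernel Algorithm -/

/-- The data that change during the algorithm: the current (rescaled) matrix `A`, the vector
`x`, and the vector `y`. -/
structure KState (m n : ℕ) where
  A : Matrix (Fin m) (Fin n) ℝ
  x : Vec n
  y : Vec m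

/-- The parameter `ε = 1 / (11 m)`. -/
def eps (m : ℕ) : ℝ := 1 / (11 * (m : ℝ))

/-- The initial state: `x` is the all-ones vector and `y = A x`. -/
def initState {m n : ℕ} (A : Matrix (Fin m) (Fin n) ℝ) : KState m n where
  A := A
  x := WithLp.toLp 2 (fun _ => 1)
  y := mulVecL A (WithLp.toLp 2 (fun _ => 1))

/-- The Dunagan-Vempala update with the column of index `k`. -/
def dvUpdate {m n : ℕ} (s : KState m n) (k : Fin n) : KState m n where
  A := s.A
  x := s.x - (inner ℝ (col s.A k) s.y / ‖col s.A k‖ ^ 2) • EuclideanSpace.single k (1 : ℝ)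
  y := s.y - (inner ℝ (hat (col s.A k)) s.y) • hat (col s.A k)

/-- The rescaling `A := (I + ŷ ŷᵀ) A`, `y := 2 y`. -/
def rescale {m n : ℕ} (s : KState m n) : KState m n where
  A := (1 + Matrix.vecMulVec (hat s.y) (hat s.y)) * s.A
  x := s.x
  y := (2 : ℝ) • s.y

/-- The exit test of the while loop: the projection of `x` to the kernel of the input matrix
`A₀` is a positive vector. -/
def Terminal {m n : ℕ} (A₀ : Matrix (Fin m) (Fin n) ℝ) (s : KState m n) : Prop :=
  ∀ j, 0 < kernelProj A₀ s.x j

/-- One pass through the body of the while loop; `k` is any minimizer of the cosine, so every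
tie-breaking is covered. -/
inductive Iteration {m n : ℕ} (s : KState m n) : KState m n → Prop
  | dv (k : Fin n) (hmin : ∀ j, cosAngle s.A s.y k ≤ cosAngle s.A s.y j)
      (hk : cosAngle s.A s.y k < -eps m) : Iteration s (dvUpdate s k)
  | rescale (k : Fin n) (hmin : ∀ j, cosAngle s.A s.y k ≤ cosAngle s.A s.y j)
      (hk : ¬ cosAngle s.A s.y k < -eps m) : Iteration s (rescale s)

/-- `s` is an execution of the algorithm on the input `A₀`: `s t` is the state after `t` passes
through the loop. The states that follow a terminal state are irrelevant. -/
def IsExecution {m n : ℕ} (A₀ : Matrix (Fin m) (Fin n) ℝ) (s : ℕ → KState m n) : Prop :=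
  s 0 = initState A₀ ∧ ∀ t, ¬ Terminal A₀ (s t) → Iteration (s t) (s (t + 1))

/-- `T` is the number of passes through the loop until the exit test succeeds. -/
def HaltsAt {m n : ℕ} (A₀ : Matrix (Fin m) (Fin n) ℝ) (s : ℕ → KState m n) (T : ℕ) : Prop :=
  Terminal A₀ (s T) ∧ ∀ t < T, ¬ Terminal A₀ (s t)

/-- The number of passes, among the first `T`, that perform a DV update: those in which the
smallest cosine is below `-ε`. -/
def dvCount {m n : ℕ} (s : ℕ → KState m n) (T : ℕ) : ℕ :=
  Set.ncard {t : ℕ | t < T ∧ ∃ k, cosAngle (s t).A (s t).y k < -eps m}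

/-! ### Counting arithmetic operations

Programs in the unit-cost arithmetic model. The numbers handled by a program have an
uninterpreted type `R`, so the only way to compute with them is through the four charged kinds
of steps below: loading an integer constant, an arithmetic operation, a strict comparison. -/

inductive ArithOp
  | add
  | sub
  | mul
  | div

inductive Prog (R : Type) (α : Type) : Type
  | ret (a : α) : Prog R α
  | const (c : ℕ) (next : R → Prog R α) : Prog R α
  | arith (op : ArithOp) (a b : R) (next : R → Prog R α) : Prog R α
  | less (a b : R) (next : Bool → Prog R α) : Prog R α

namespace Prog

variable {R α β : Type}

/-- Sequential composition. -/
def bind : Prog R α → (α → Prog R β) → Prog R β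
  | ret a, f => f a
  | const c next, f => const c (fun r => (next r).bind f)
  | arith op a b next, f => arith op a b (fun r => (next r).bind f)
  | less a b next, f => less a b (fun r => (next r).bind f)

instance : Monad (Prog R) where
  pure := ret
  bind := bind

end Prog

/-- The value of an arithmetic operation. (The programs below divide only by positive numbers:
squared norms of nonzero vectors.) -/
def ArithOp.eval {K : Type} [Field K] : ArithOp → K → K → K
  | add, a, b => a + b
  | sub, a, b => a - b
  | mul, a, b => a * b
  | div, a, b => a / b

/-- The result of a program on the numbers of an ordered field, with the number of charged
steps: each constant, arithmetic operation and comparison costs one. -/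
def Prog.run {K : Type} [Field K] [LinearOrder K] {α : Type} : Prog K α → α × ℕ
  | ret a => (a, 0)
  | const c next => ((next (c : K)).run.1, (next (c : K)).run.2 + 1)
  | arith op a b next => ((next (op.eval a b)).run.1, (next (op.eval a b)).run.2 + 1)
  | less a b next => ((next (decide (a < b))).run.1, (next (decide (a < b))).run.2 + 1)

namespace Prog

variable {R α β : Type}

def num (c : ℕ) : Prog R R := const c ret
def plus (a b : R) : Prog R R := arith ArithOp.add a b ret
def minus (a b : R) : Prog R R := arith ArithOp.sub a b ret
def times (a b : R) : Prog R R := arith ArithOp.mul a b ret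
def quot (a b : R) : Prog R R := arith ArithOp.div a b ret
def lt (a b : R) : Prog R Bool := less a b ret

/-- Run `f 0, …, f (n - 1)` in this order and store the results in an array. -/
def tabulate : (n : ℕ) → (Fin n → Prog R α) → Prog R (Fin n → α)
  | 0, _ => pure Fin.elim0
  | n + 1, f => do
    let a ← f 0
    let v ← tabulate n (fun i => f i.succ)
    pure (Fin.cons a v)

/-- The inner product of two arrays. -/
def dot : {n : ℕ} → (Fin n → R) → (Fin n → R) → Prog R R
  | 0, _, _ => num 0
  | _ + 1, u, v => do
    let s ← dot (fun i => u i.succ) (fun i => v i.succ)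
    let p ← times (u 0) (v 0)
    plus p s

/-- `v - c u`. -/
def subMul {n : ℕ} (v : Fin n → R) (c : R) (u : Fin n → R) : Prog R (Fin n → R) :=
  tabulate n (fun i => do
    let p ← times c (u i)
    minus (v i) p)

/-- `v + c u`. -/
def addMul {n : ℕ} (v : Fin n → R) (c : R) (u : Fin n → R) : Prog R (Fin n → R) :=
  tabulate n (fun i => do
    let p ← times c (u i)
    plus (v i) p)

/-- Is every entry positive? -/
def allPos : {n : ℕ} → (Fin n → R) → Prog R Bool
  | 0, _ => pure true
  | _ + 1, v => do
    let o ← num 0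
    let b ← lt o (v 0)
    if b then allPos (fun i => v i.succ) else pure false

/-- The first index of a smallest entry of a nonempty array, with that entry. -/
def argmin : {n : ℕ} → (Fin (n + 1) → R) → Prog R (Fin (n + 1) × R)
  | 0, v => pure (0, v 0)
  | _ + 1, v => do
    let p ← argmin (fun i => v i.succ)
    let b ← lt p.2 (v 0)
    if b then pure (p.1.succ, p.2) else pure (0, v 0)

/-- Orthogonalize `v` against a list of nonzero, pairwise orthogonal vectors, each stored with
its squared norm. -/
def project {n : ℕ} : List ((Fin n → R) × R) → (Fin n → R) → Prog R (Fin n → R)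
  | [], v => pure v
  | (b, s) :: L, v => do
    let d ← dot v b
    let c ← quot d s
    let w ← subMul v c b
    project L w

/-- Gram-Schmidt without normalization: an orthogonal basis of the span of a list of vectors,
each basis vector stored with its squared norm. -/
def gramSchmidt {n : ℕ} : List (Fin n → R) → Prog R (List ((Fin n → R) × R))
  | [] => pure []
  | r :: rs => do
    let L ← gramSchmidt rs
    let w ← project L r
    let s ← dot w w
    let o ← num 0
    let b ← lt o s
    if b then pure ((w, s) :: L) else pure L

/-- The memory of the implementation, for the current matrix `A`, the current `x`, and
`y = A x`. -/
structure Work (R : Type) (m n : ℕ) where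
  /-- orthogonal basis of the row space of the input matrix -/
  basis : List ((Fin n → R) × R)
  /-- the current matrix -/
  A : Fin m → Fin n → R
  /-- the current `x` -/
  x : Fin n → R
  /-- `‖y‖²` -/
  eta : R
  /-- `Aᵀ y` -/
  z : Fin n → R
  /-- the squared norms of the columns of `A` -/
  sq : Fin n → R
  /-- the projection of `x` to the kernel of the input matrix -/
  xbar : Fin n → R
  /-- for the indices `k` used so far, the `k`-th column of `Aᵀ A` and the `k`-th column of the
  projection matrix -/
  cache : Fin n → Option ((Fin n → R) × (Fin n → R))

/-- Initialization. -/
def initWork {m n : ℕ} (A : Fin m → Fin n → R) : Prog R (Work R m n) := do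
  let basis ← gramSchmidt (List.ofFn A)
  let x ← tabulate n (fun _ => num 1)
  let y ← tabulate m (fun i => dot (A i) x)
  let eta ← dot y y
  let z ← tabulate n (fun j => dot (fun i => A i j) y)
  let sq ← tabulate n (fun j => dot (fun i => A i j) (fun i => A i j))
  let xbar ← project basis x
  pure ⟨basis, A, x, eta, z, sq, xbar, fun _ => none⟩

/-- The `k`-th columns of `Aᵀ A` and of the projection matrix, computed when they are used for
the first time. -/
def fetch {m n : ℕ} (w : Work R m n) (k : Fin n) : Prog R ((Fin n → R) × (Fin n → R)) :=
  match w.cache k with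
  | some p => pure p
  | none => do
    let f ← tabulate n (fun j => dot (fun i => w.A i j) (fun i => w.A i k))
    let e ← tabulate n (fun j => if j = k then num 1 else num 0)
    let p ← project w.basis e
    pure (f, p)

/-- The number `z |z| / s`. With `z = ⟪a, y⟫` and `s = ‖a‖²` it is an increasing function of the
cosine `z / (√s ‖y‖)`, namely `‖y‖²` times its signed square. -/
def signedSq (z s : R) : Prog R R := do
  let p ← times z z
  let q ← quot p s
  let o ← num 0
  let b ← lt z o
  if b then minus o q else pure q

/-- The DV update with index `k`. -/
def dvWork {m n : ℕ} (w : Work R m n) (k : Fin n) : Prog R (Work R m n) := do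
  let p ← fetch w k
  let c ← quot (w.z k) (w.sq k)
  let xk ← minus (w.x k) c
  let d ← times (w.z k) c
  let eta ← minus w.eta d
  let z ← subMul w.z c p.1
  let xbar ← subMul w.xbar c p.2
  pure { w with
    x := Function.update w.x k xk
    eta := eta
    z := z
    xbar := xbar
    cache := Function.update w.cache k (some p) }

/-- The rescaling: `A := A + y zᵀ / ‖y‖²`, so that `Aᵀ A` changes by `3 z zᵀ / ‖y‖²`, the
squared norm of `y` is multiplied by `4` and so is `z`. -/
def rescaleWork {m n : ℕ} (w : Work R m n) : Prog R (Work R m n) := do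
  let y ← tabulate m (fun i => dot (w.A i) w.x)
  let A ← tabulate m (fun i => do
    let c ← quot (y i) w.eta
    addMul (w.A i) c w.z)
  let three ← num 3
  let four ← num 4
  let g ← tabulate n (fun j => do
    let p ← times three (w.z j)
    quot p w.eta)
  let sq ← tabulate n (fun j => do
    let p ← times (g j) (w.z j)
    plus (w.sq j) p)
  let cache ← tabulate n (fun k =>
    match w.cache k with
    | none => pure none
    | some p => do
      let f ← addMul p.1 (g k) w.z
      pure (some (f, p.2)))
  let eta ← times four w.eta
  let z ← tabulate n (fun j => times four (w.z j))
  pure { w with A := A, eta := eta, z := z, sq := sq, cache := cache }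

/-- One pass through the while loop: `Sum.inr w` if the exit test succeeds in memory state `w`,
and `Sum.inl w'` with the next memory state `w'` otherwise. The test whether the smallest
cosine is below `-1 / (11 m)` is done in the form `(11 m)² (z |z| / s) < - ‖y‖²`. -/
def loopBody {m n : ℕ} (w : Work R m (n + 1)) :
    Prog R (Work R m (n + 1) ⊕ Work R m (n + 1)) := do
  let done ← allPos w.xbar
  if done then pure (Sum.inr w) else do
    let keys ← tabulate (n + 1) (fun j => signedSq (w.z j) (w.sq j))
    let p ← argmin keys
    let c ← num (121 * m ^ 2)
    let l ← times c p.2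
    let o ← num 0
    let r ← minus o w.eta
    let b ← lt l r
    if b then do
      let w' ← dvWork w p.1
      pure (Sum.inl w')
    else do
      let w' ← rescaleWork w
      pure (Sum.inl w')

end Prog

/-- Run a loop with at most `N` passes. The result is `none` if the loop is not left within
`N` passes, and otherwise the value with which it is left and the total number of operations. -/
def whileRun {K : Type} [Field K] [LinearOrder K] {σ τ : Type} (body : σ → Prog K (σ ⊕ τ)) :
    ℕ → σ → Option (τ × ℕ)
  | 0, _ => none
  | N + 1, s =>
    match (body s).run with
    | (Sum.inr o, c) => some (o, c)
    | (Sum.inl s', c) => (whileRun body N s').map (fun r => (r.1, c + r.2))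

/-- The implementation of the algorithm: the memory state at the exit from the loop, whose
entry `xbar` is the output, and the number of arithmetic operations of the whole computation,
if there are at most `N` evaluations of the exit test. (For a matrix without columns there is
nothing to do.) -/
def implementation {K : Type} [Field K] [LinearOrder K] {m : ℕ} :
    {n : ℕ} → (Fin m → Fin n → K) → ℕ → Option (Prog.Work K m n × ℕ)
  | 0, A, _ => some (Prog.initWork A).run
  | _ + 1, A, N =>
    (whileRun Prog.loopBody N (Prog.initWork A).run.1).map
      (fun r => (r.1, (Prog.initWork A).run.2 + r.2))

end KernelAlg

end

/-! Every rescaled matrix has the form `M * A`, where `A` is the input and `M` never shrinks a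
vector. Two facts about the Goffin measure ρ < 0 carry the analysis.

First, `Aᵀ` shrinks no vector of the image of `A` by more than the factor |ρ|, because some column
has cosine at most ρ with it. By duality |ρ| ‖x - Πx‖ ≤ ‖A x‖ ≤ ‖M A x‖ = ‖y‖. A DV update only
increases coordinates of `x`, so `x ≥ 1` throughout, and ‖y‖ < |ρ| forces Πx > 0. Before
termination, therefore, ‖y‖ ≥ |ρ| (`Inv.abs_goffin_le_norm_y`).

Second, by separation, the ball of radius |ρ| in the image lies in the convex hull of the normalized
columns (`exists_convexCombination`). A rescaling happens only when all columns have cosine at least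
-ε with `y`. Since the ball is symmetric, its image under the current `M` is then thin in the
direction of `y`, and after the expansion it still lies in the new hull, with 0 allowed as an extra
point, enlarged by 1 + 3ε (`exists_combination_expand`). After `R` rescalings `M` thus stretches the
image by at most (1 + 3ε)^R / |ρ| and is the identity on the orthogonal complement, while det M =
2^R. Comparing volumes with 3εm = 3/11 < log 2 gives R = O(m log |ρ|⁻¹) (`Inv.two_pow_le`,
`Inv.rescale_count_le`).

The potential ‖y‖² starts at most n², is multiplied by 4 in a rescaling and by at most 1 - ε² in a
DV update. Being at least ρ² before termination, it bounds the number of DV updates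
(`Inv.dv_count_le`).

For the operation count, a simulation relation (`Represents`, `exists_simulation`) ties the memory
to an execution. A DV update costs O(n), plus O(mn) when its column is used for the first time; a
rescaling costs O(mn + n²). At most n first uses cost O(mn²), which log |ρ|⁻¹ absorbs if |ρ| < 1/2.
If |ρ| ≥ 1/2, no rescaling occurs and ‖y‖² drops by the factor 3/4 in each pass (`FastInv`), so
there are only O(log n) passes and hence O(log n) first uses. -/

noncomputable section
namespace KernelAlg
namespace Prog

variable {α β : Type}

/-! ### Values and costs of the basic programs -/

@[simp] theorem run_pure (a : α) : (pure a : Prog ℝ α).run = (a, 0) := rfl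

theorem run_bind_def (p : Prog ℝ α) (f : α → Prog ℝ β) :
    (p.bind f).run = ((f p.run.1).run.1, p.run.2 + (f p.run.1).run.2) := by
  induction p with
  | ret a => simp [bind, run]
  | const c next ih => simp [bind, run, ih]; omega
  | arith op a b next ih => simp [bind, run, ih]; omega
  | less a b next ih => simp [bind, run, ih]; omega

@[simp] theorem run_bind_fst (p : Prog ℝ α) (f : α → Prog ℝ β) :
    (p >>= f).run.1 = (f p.run.1).run.1 := by
  change (p.bind f).run.1 = _
  rw [run_bind_def]

@[simp] theorem run_bind_snd (p : Prog ℝ α) (f : α → Prog ℝ β) :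
    (p >>= f).run.2 = p.run.2 + (f p.run.1).run.2 := by
  change (p.bind f).run.2 = _
  rw [run_bind_def]

@[simp] theorem run_num (c : ℕ) : (num c : Prog ℝ ℝ).run = ((c : ℝ), 1) := rfl
@[simp] theorem run_plus (a b : ℝ) : (plus a b).run = (a + b, 1) := rfl
@[simp] theorem run_minus (a b : ℝ) : (minus a b).run = (a - b, 1) := rfl
@[simp] theorem run_times (a b : ℝ) : (times a b).run = (a * b, 1) := rfl
@[simp] theorem run_quot (a b : ℝ) : (quot a b).run = (a / b, 1) := rfl
@[simp] theorem run_lt (a b : ℝ) : (lt a b).run = (decide (a < b), 1) := rfl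

@[simp] theorem tabulate_fst : ∀ (n : ℕ) (f : Fin n → Prog ℝ α),
    (tabulate n f).run.1 = fun i => (f i).run.1
  | 0, f => by funext i; exact i.elim0
  | n + 1, f => by
    simp only [tabulate, run_bind_fst, run_pure]
    rw [tabulate_fst n]
    funext i
    refine Fin.cases ?_ (fun i => ?_) i <;> simp

theorem tabulate_snd_le {c : ℕ} : ∀ (n : ℕ) (f : Fin n → Prog ℝ α),
    (∀ i, (f i).run.2 ≤ c) → (tabulate n f).run.2 ≤ n * c
  | 0, f, _ => by simp [tabulate]
  | n + 1, f, h => by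
    have h0 := h 0
    have h1 := tabulate_snd_le n (fun i => f i.succ) (fun i => h i.succ)
    simp only [tabulate, run_bind_snd, run_pure]
    rw [add_mul]
    omega

@[simp] theorem dot_fst : ∀ {n : ℕ} (u v : Fin n → ℝ), (dot u v).run.1 = u ⬝ᵥ v
  | 0, u, v => by simp [dot]
  | n + 1, u, v => by
    simp only [dot, run_bind_fst, run_plus, run_times]
    rw [dot_fst, dotProduct, dotProduct, Fin.sum_univ_succ]

@[simp] theorem dot_snd : ∀ {n : ℕ} (u v : Fin n → ℝ), (dot u v).run.2 = 2 * n + 1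
  | 0, u, v => by simp [dot]
  | n + 1, u, v => by
    simp only [dot, run_bind_snd, run_plus, run_times]
    rw [dot_snd]
    omega

@[simp] theorem subMul_fst {n : ℕ} (v : Fin n → ℝ) (c : ℝ) (u : Fin n → ℝ) :
    (subMul v c u).run.1 = v - c • u := by
  funext i
  simp [subMul]

theorem subMul_snd_le {n : ℕ} (v : Fin n → ℝ) (c : ℝ) (u : Fin n → ℝ) :
    (subMul v c u).run.2 ≤ n * 2 :=
  tabulate_snd_le n _ (fun i => by simp)

@[simp] theorem addMul_fst {n : ℕ} (v : Fin n → ℝ) (c : ℝ) (u : Fin n → ℝ) :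
    (addMul v c u).run.1 = v + c • u := by
  funext i
  simp [addMul]

theorem addMul_snd_le {n : ℕ} (v : Fin n → ℝ) (c : ℝ) (u : Fin n → ℝ) :
    (addMul v c u).run.2 ≤ n * 2 :=
  tabulate_snd_le n _ (fun i => by simp)

theorem allPos_fst : ∀ {n : ℕ} (v : Fin n → ℝ), (allPos v).run.1 = true ↔ ∀ i, 0 < v i
  | 0, v => by simp [allPos]
  | n + 1, v => by
    simp only [allPos, run_bind_fst, run_num, run_lt, Nat.cast_zero, decide_eq_true_eq]
    rw [Fin.forall_fin_succ]
    split_ifs with h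
    · simp [h, allPos_fst]
    · simp [h]

theorem allPos_snd_le : ∀ {n : ℕ} (v : Fin n → ℝ), (allPos v).run.2 ≤ 2 * n
  | 0, v => by simp [allPos]
  | n + 1, v => by
    have ih := allPos_snd_le (fun i => v i.succ)
    simp only [allPos, run_bind_snd, run_num, run_lt, Nat.cast_zero, decide_eq_true_eq]
    split_ifs with h
    · omega
    · simp

theorem argmin_fst : ∀ {n : ℕ} (v : Fin (n + 1) → ℝ),
    (argmin v).run.1.2 = v (argmin v).run.1.1 ∧ ∀ j, v (argmin v).run.1.1 ≤ v j
  | 0, v => by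
    refine ⟨rfl, fun j => ?_⟩
    rw [show j = (argmin v).run.1.1 from Subsingleton.elim (α := Fin 1) _ _]
  | n + 1, v => by
    obtain ⟨h1, h2⟩ := argmin_fst (fun i => v i.succ)
    simp only [argmin, run_bind_fst, run_lt, decide_eq_true_eq]
    split_ifs with h
    · refine ⟨h1, fun j => ?_⟩
      refine Fin.cases ?_ (fun i => ?_) j
      · simpa [← h1] using h.le
      · exact h2 i
    · refine ⟨rfl, fun j => ?_⟩
      refine Fin.cases ?_ (fun i => ?_) j
      · simp
      · rw [not_lt, h1] at h
        exact h.trans (h2 i)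

theorem argmin_snd : ∀ {n : ℕ} (v : Fin (n + 1) → ℝ), (argmin v).run.2 = n
  | 0, v => by simp [argmin]
  | n + 1, v => by
    have ih := argmin_snd (fun i => v i.succ)
    simp only [argmin, run_bind_snd, run_lt, decide_eq_true_eq]
    split_ifs with h <;> simp [ih]

theorem signedSq_fst (z s : ℝ) :
    (signedSq z s).run.1 = if z < 0 then -(z * z / s) else z * z / s := by
  simp only [signedSq, run_bind_fst, run_times, run_quot, run_num, run_lt, Nat.cast_zero,
    decide_eq_true_eq]
  split_ifs <;> simp

theorem signedSq_snd_le (z s : ℝ) : (signedSq z s).run.2 ≤ 5 := by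
  simp only [signedSq, run_bind_snd, run_times, run_quot, run_num, run_lt, Nat.cast_zero,
    decide_eq_true_eq]
  split_ifs <;> simp

/-! ### Gram-Schmidt -/

/-- A list of pairwise orthogonal nonzero vectors, each stored with its squared norm. -/
def IsOrthoList {n : ℕ} (L : List ((Fin n → ℝ) × ℝ)) : Prop :=
  (∀ p ∈ L, p.2 = p.1 ⬝ᵥ p.1 ∧ 0 < p.2) ∧ L.Pairwise (fun p q => p.1 ⬝ᵥ q.1 = 0)

/-- The span of the vectors stored in a list. -/
def listSpan {n : ℕ} (L : List ((Fin n → ℝ) × ℝ)) : Submodule ℝ (Fin n → ℝ) :=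
  Submodule.span ℝ {v | ∃ p ∈ L, p.1 = v}

theorem listSpan_nil {n : ℕ} : listSpan ([] : List ((Fin n → ℝ) × ℝ)) = ⊥ := by
  simp [listSpan]

theorem listSpan_cons {n : ℕ} (p : (Fin n → ℝ) × ℝ) (L : List ((Fin n → ℝ) × ℝ)) :
    listSpan (p :: L) = Submodule.span ℝ {p.1} ⊔ listSpan L := by
  rw [listSpan, listSpan, ← Submodule.span_union]
  congr 1
  ext v
  simp [eq_comm]

theorem project_snd_le {n : ℕ} : ∀ (L : List ((Fin n → ℝ) × ℝ)) (v : Fin n → ℝ),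
    (project L v).run.2 ≤ L.length * (4 * n + 2)
  | [], v => by simp [project]
  | (b, s) :: L, v => by
    simp only [project, run_bind_snd, dot_snd, run_quot, subMul_fst, dot_fst, List.length_cons]
    have h1 := subMul_snd_le v (v ⬝ᵥ b / s) b
    have h2 := project_snd_le L (v - (v ⬝ᵥ b / s) • b)
    rw [add_mul]
    omega

theorem sub_project_mem {n : ℕ} : ∀ (L : List ((Fin n → ℝ) × ℝ)) (v : Fin n → ℝ),
    v - (project L v).run.1 ∈ listSpan L
  | [], v => by simp [project]
  | (b, s) :: L, v => by
    simp only [project, run_bind_fst, run_quot, subMul_fst, dot_fst, listSpan_cons]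
    have h := sub_project_mem L (v - (v ⬝ᵥ b / s) • b)
    have h' : (v ⬝ᵥ b / s) • b ∈ Submodule.span ℝ {b} :=
      Submodule.smul_mem _ _ (Submodule.mem_span_singleton_self b)
    have := Submodule.add_mem_sup h' h
    convert this using 1
    abel

/-- Only multiples of vectors orthogonal to `b` are subtracted. This protects the orthogonality
gained at the head of the list from the later steps. -/
theorem project_dotProduct_of_forall {n : ℕ} : ∀ (L : List ((Fin n → ℝ) × ℝ)) (v b : Fin n → ℝ),
    (∀ p ∈ L, p.1 ⬝ᵥ b = 0) → (project L v).run.1 ⬝ᵥ b = v ⬝ᵥ b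
  | [], v, b, _ => by simp [project]
  | (a, s) :: L, v, b, h => by
    simp only [project, run_bind_fst, run_quot, subMul_fst, dot_fst]
    rw [project_dotProduct_of_forall L _ b (fun p hp => h p (List.mem_cons_of_mem _ hp))]
    have := h (a, s) List.mem_cons_self
    simp only at this
    simp [sub_dotProduct, smul_dotProduct, this]

theorem project_dotProduct_eq_zero {n : ℕ} : ∀ (L : List ((Fin n → ℝ) × ℝ)) (v : Fin n → ℝ),
    IsOrthoList L → ∀ p ∈ L, (project L v).run.1 ⬝ᵥ p.1 = 0
  | [], v, _ => by simp
  | (a, s) :: L, v, h => by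
    obtain ⟨h1, h2⟩ := h
    rw [List.pairwise_cons] at h2
    simp only [project, run_bind_fst, run_quot, subMul_fst, dot_fst]
    intro p hp
    rcases List.mem_cons.1 hp with rfl | hp
    · rw [project_dotProduct_of_forall]
      · obtain ⟨hs, hpos⟩ := h1 _ hp
        simp only at hs hpos ⊢
        rw [sub_dotProduct, smul_dotProduct, ← hs, smul_eq_mul, div_mul_cancel₀ _ hpos.ne', sub_self]
      · intro q hq
        rw [dotProduct_comm]
        exact h2.1 q hq
    · exact project_dotProduct_eq_zero L _
        ⟨fun q hq => h1 q (List.mem_cons_of_mem _ hq), h2.2⟩ p hp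

/-- A residue is kept exactly when it is nonzero, which keeps the divisors positive. The length
bound serves the cost estimates. -/
theorem gramSchmidt_spec {n : ℕ} : ∀ rs : List (Fin n → ℝ),
    IsOrthoList (gramSchmidt rs).run.1 ∧
      listSpan (gramSchmidt rs).run.1 = Submodule.span ℝ {v | v ∈ rs} ∧
      (gramSchmidt rs).run.1.length ≤ rs.length
  | [] => by simp [gramSchmidt, IsOrthoList, listSpan_nil]
  | r :: rs => by
    obtain ⟨h1, h2, h3⟩ := gramSchmidt_spec rs
    have hset : {v | v ∈ r :: rs} = {r} ∪ {v | v ∈ rs} := by ext v; simp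
    have hmem := sub_project_mem (gramSchmidt rs).run.1 r
    have horth := project_dotProduct_eq_zero (gramSchmidt rs).run.1 r h1
    simp only [gramSchmidt, run_bind_fst, dot_fst, run_num, run_lt, Nat.cast_zero,
      decide_eq_true_eq]
    set L := (gramSchmidt rs).run.1
    set w := (project L r).run.1
    split_ifs with h
    · refine ⟨⟨?_, ?_⟩, ?_, by simpa using h3⟩
      · intro p hp
        rcases List.mem_cons.1 hp with rfl | hp
        · exact ⟨rfl, h⟩
        · exact h1.1 p hp
      · exact List.pairwise_cons.2 ⟨fun q hq => horth q hq, h1.2⟩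
      · simp only [run_pure]
        rw [listSpan_cons, hset, Submodule.span_union, ← h2]
        apply le_antisymm
        · refine sup_le ?_ le_sup_right
          rw [Submodule.span_singleton_le_iff_mem]
          have : w = r - (r - w) := by abel
          simp only
          rw [this]
          exact Submodule.sub_mem _ (Submodule.mem_sup_left (Submodule.mem_span_singleton_self r))
            (Submodule.mem_sup_right hmem)
        · refine sup_le ?_ le_sup_right
          rw [Submodule.span_singleton_le_iff_mem]
          have : r = w + (r - w) := by abel
          rw [this]
          exact Submodule.add_mem_sup (Submodule.mem_span_singleton_self w) hmem
    -- The residue vanishes, so `r` already lies in the span of the earlier vectors.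
    · have hw : w = 0 := by
        have h0 : w ⬝ᵥ w = 0 := by
          have hnn : 0 ≤ w ⬝ᵥ w := Finset.sum_nonneg fun i _ => mul_self_nonneg _
          exact le_antisymm (not_lt.1 h) hnn
        exact dotProduct_self_eq_zero.1 h0
      refine ⟨h1, ?_, h3.trans (by simp)⟩
      simp only [run_pure]
      rw [hset, Submodule.span_union, ← h2]
      symm
      rw [sup_eq_right, Submodule.span_singleton_le_iff_mem]
      rwa [hw, sub_zero] at hmem

theorem gramSchmidt_snd_le {n : ℕ} : ∀ rs : List (Fin n → ℝ),
    (gramSchmidt rs).run.2 ≤ rs.length * (rs.length * (4 * n + 2) + 2 * n + 3)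
  | [] => by simp [gramSchmidt]
  | r :: rs => by
    have ih := gramSchmidt_snd_le rs
    obtain ⟨-, -, h3⟩ := gramSchmidt_spec rs
    have hp := project_snd_le (gramSchmidt rs).run.1 r
    have hp' := hp.trans (Nat.mul_le_mul_right (4 * n + 2) h3)
    simp only [gramSchmidt, run_bind_snd, dot_snd, dot_fst, run_num, run_lt, Nat.cast_zero,
      decide_eq_true_eq, List.length_cons]
    split_ifs with h <;> simp only [run_pure] <;> nlinarith

end Prog
variable {m n : ℕ}

/-! ### Linear algebra of matrices on Euclidean space -/

theorem mulVecL_apply (A : Matrix (Fin m) (Fin n) ℝ) (x : Vec n) (i : Fin m) :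
    mulVecL A x i = (fun j => A i j) ⬝ᵥ x.ofLp := rfl

theorem col_apply (A : Matrix (Fin m) (Fin n) ℝ) (j : Fin n) (i : Fin m) :
    col A j i = A i j := rfl

theorem inner_eq_dotProduct {d : ℕ} (u v : Vec d) : inner ℝ u v = u.ofLp ⬝ᵥ v.ofLp := by
  rw [EuclideanSpace.inner_eq_star_dotProduct, dotProduct_comm]
  simp

theorem norm_sq_eq_dotProduct {d : ℕ} (u : Vec d) : ‖u‖ ^ 2 = u.ofLp ⬝ᵥ u.ofLp := by
  rw [← inner_eq_dotProduct, real_inner_self_eq_norm_sq]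

theorem mulVecL_eq_sum (A : Matrix (Fin m) (Fin n) ℝ) (x : Vec n) :
    mulVecL A x = ∑ j, x j • col A j := by
  ext i
  simp [mulVecL_apply, dotProduct, col_apply, mul_comm]

theorem mulVecL_single (A : Matrix (Fin m) (Fin n) ℝ) (k : Fin n) :
    mulVecL A (EuclideanSpace.single k (1 : ℝ)) = col A k := by
  ext i
  simp [mulVecL_apply, col_apply, dotProduct]

theorem mulVecL_mul {l : ℕ} (M : Matrix (Fin l) (Fin m) ℝ) (A : Matrix (Fin m) (Fin n) ℝ)
    (x : Vec n) : mulVecL (M * A) x = mulVecL M (mulVecL A x) := by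
  ext i
  change ((M * A) *ᵥ x.ofLp) i = (M *ᵥ (A *ᵥ x.ofLp)) i
  rw [Matrix.mulVec_mulVec]

theorem col_mul {l : ℕ} (M : Matrix (Fin l) (Fin m) ℝ) (A : Matrix (Fin m) (Fin n) ℝ)
    (j : Fin n) : col (M * A) j = mulVecL M (col A j) := by
  rw [← mulVecL_single, mulVecL_mul, mulVecL_single]

theorem inner_mulVecL_transpose (A : Matrix (Fin m) (Fin n) ℝ) (w : Vec m) (x : Vec n) :
    inner ℝ (mulVecL Aᵀ w) x = inner ℝ w (mulVecL A x) := by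
  rw [inner_eq_dotProduct, inner_eq_dotProduct]
  change (Aᵀ *ᵥ w.ofLp) ⬝ᵥ x.ofLp = w.ofLp ⬝ᵥ (A *ᵥ x.ofLp)
  rw [Matrix.mulVec_transpose, Matrix.dotProduct_mulVec]

theorem mulVecL_transpose_apply (A : Matrix (Fin m) (Fin n) ℝ) (w : Vec m) (j : Fin n) :
    mulVecL Aᵀ w j = inner ℝ (col A j) w := by
  rw [inner_eq_dotProduct]; rfl

theorem ker_mulVecL (A : Matrix (Fin m) (Fin n) ℝ) :
    LinearMap.ker (mulVecL A) = (LinearMap.range (mulVecL Aᵀ))ᗮ := by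
  ext x
  rw [LinearMap.mem_ker, Submodule.mem_orthogonal]
  constructor
  · rintro hx _ ⟨w, rfl⟩
    rw [inner_mulVecL_transpose, hx, inner_zero_right]
  · intro h
    have := h _ ⟨mulVecL A x, rfl⟩
    rwa [inner_mulVecL_transpose, inner_self_eq_zero] at this

theorem ker_mulVecL_orthogonal (A : Matrix (Fin m) (Fin n) ℝ) :
    (LinearMap.ker (mulVecL A))ᗮ = LinearMap.range (mulVecL Aᵀ) := by
  rw [ker_mulVecL, Submodule.orthogonal_orthogonal]

theorem col_mem_range (A : Matrix (Fin m) (Fin n) ℝ) (j : Fin n) :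
    col A j ∈ LinearMap.range (mulVecL A) :=
  ⟨_, mulVecL_single A j⟩

theorem norm_hat {d : ℕ} {v : Vec d} (hv : v ≠ 0) : ‖hat v‖ = 1 := by
  rw [hat, norm_smul, norm_inv, norm_norm, inv_mul_cancel₀ (norm_ne_zero_iff.2 hv)]

theorem norm_hat_le {d : ℕ} (v : Vec d) : ‖hat v‖ ≤ 1 := by
  by_cases hv : v = 0
  · simp [hat, hv]
  · exact (norm_hat hv).le

theorem norm_smul_hat {d : ℕ} (v : Vec d) : ‖v‖ • hat v = v := by
  by_cases hv : v = 0
  · simp [hv]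
  · rw [hat, smul_smul, mul_inv_cancel₀ (norm_ne_zero_iff.2 hv), one_smul]

theorem hat_smul {d : ℕ} {c : ℝ} (hc : 0 < c) (v : Vec d) : hat (c • v) = hat v := by
  rw [hat, hat, norm_smul, Real.norm_of_nonneg hc.le, smul_smul, mul_inv, mul_right_comm,
    inv_mul_cancel₀ hc.ne', one_mul]

theorem norm_mul_cosAngle (A : Matrix (Fin m) (Fin n) ℝ) (y : Vec m) (j : Fin n) :
    ‖y‖ * cosAngle A y j = inner ℝ (hat (col A j)) y := by
  conv_rhs => rw [← norm_smul_hat y]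
  rw [inner_smul_right, cosAngle]

theorem abs_cosAngle_le (A : Matrix (Fin m) (Fin n) ℝ) (y : Vec m) (j : Fin n) :
    |cosAngle A y j| ≤ 1 :=
  (abs_real_inner_le_norm _ _).trans
    (mul_le_one₀ (norm_hat_le _) (norm_nonneg _) (norm_hat_le _))

/-! ### The Goffin measure -/

theorem exists_cosAngle_le_goffin [Nonempty (Fin n)] (A : Matrix (Fin m) (Fin n) ℝ) {y : Vec m}
    (hy : y ∈ LinearMap.range (mulVecL A)) (hy0 : y ≠ 0) : ∃ j, cosAngle A y j ≤ goffin A := by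
  obtain ⟨j, hj⟩ := exists_eq_ciInf_of_finite (f := cosAngle A y)
  refine ⟨j, ?_⟩
  rw [hj]
  -- Cosines are at most 1; without an upper bound `sSup` would have its default value.
  refine le_csSup ⟨1, ?_⟩ ⟨y, hy, hy0, rfl⟩
  rintro _ ⟨z, -, -, rfl⟩
  obtain ⟨i, hi⟩ := exists_eq_ciInf_of_finite (f := cosAngle A z)
  rw [← hi]
  exact (abs_le.1 (abs_cosAngle_le A z i)).2

/-- Every vector of the image whose norm is at most the absolute value of the Goffin measure is
a convex combination of the normalized columns. -/
theorem exists_convexCombination [Nonempty (Fin n)] {A : Matrix (Fin m) (Fin n) ℝ}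
    (hA : goffin A < 0) {v : Vec m} (hv : v ∈ LinearMap.range (mulVecL A))
    (hle : ‖v‖ ≤ |goffin A|) :
    ∃ c : Fin n → ℝ, (∀ j, 0 ≤ c j) ∧ ∑ j, c j = 1 ∧ v = ∑ j, c j • hat (col A j) := by
  set V := LinearMap.range (mulVecL A)
  let f : (Fin n → ℝ) →ₗ[ℝ] Vec m := Fintype.linearCombination ℝ (fun j => hat (col A j))
  have hf : ∀ c, f c = ∑ j, c j • hat (col A j) := fun c =>
    Fintype.linearCombination_apply ℝ _ c
  by_cases hmem : v ∈ f '' stdSimplex ℝ (Fin n)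
  · obtain ⟨c, ⟨h0, h1⟩, rfl⟩ := hmem
    exact ⟨c, h0, h1, hf c⟩
  exfalso
  have hcomp : IsCompact (f '' stdSimplex ℝ (Fin n)) :=
    (isCompact_stdSimplex ℝ (Fin n)).image f.continuous_of_finiteDimensional
  obtain ⟨g, u, hgv, hg⟩ := geometric_hahn_banach_point_closed
    ((convex_stdSimplex ℝ (Fin n)).linear_image f) hcomp.isClosed hmem
  have hgj : ∀ j, u < g (hat (col A j)) := fun j => hg _ ⟨Pi.single j 1, by
    refine ⟨fun i => ?_, by simp⟩
    by_cases h : i = j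
    · subst h; simp
    · simp [h], by
    rw [hf]; simp [Pi.single_apply]⟩
  let w := (InnerProductSpace.toDual ℝ (Vec m)).symm g
  have hw : ∀ z, g z = inner ℝ w z := fun z => (InnerProductSpace.toDual_symm_apply).symm
  let p := V.starProjection w
  have hp : p ∈ V := Submodule.starProjection_apply_mem V w
  have hpz : ∀ z ∈ V, g z = inner ℝ p z := by
    intro z hz
    rw [hw, ← sub_eq_zero, ← inner_sub_left]
    exact Submodule.inner_left_of_mem_orthogonal hz (Submodule.sub_starProjection_mem_orthogonal w)
  have hcolV : ∀ j, hat (col A j) ∈ V := fun j => V.smul_mem _ (col_mem_range A j)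
  by_cases hp0 : p = 0
  · have h1 := hgj (Classical.arbitrary _)
    rw [hpz _ (hcolV _), hp0, inner_zero_left] at h1
    rw [hpz _ hv, hp0, inner_zero_left] at hgv
    linarith
  -- Some normalized column has inner product at most ρ‖p‖ with `p`, which is no larger than ⟪p, v⟫
  -- by Cauchy-Schwarz; separation demands the opposite strict inequality.
  · obtain ⟨j, hj⟩ := exists_cosAngle_le_goffin A hp hp0
    have h1 := hgj j
    rw [hpz _ (hcolV _), real_inner_comm, ← norm_mul_cosAngle] at h1
    rw [hpz _ hv] at hgv
    have h2 := (abs_le.1 (abs_real_inner_le_norm p v)).1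
    rw [abs_of_neg hA] at hle
    have h3 : ‖p‖ * ‖v‖ ≤ ‖p‖ * -goffin A := mul_le_mul_of_nonneg_left hle (norm_nonneg _)
    have h4 := mul_le_mul_of_nonneg_left hj (norm_nonneg p)
    linarith

/-! ### Rank-one expansions -/

theorem mulVecL_one_add_vecMulVec (u v : Vec m) :
    mulVecL (1 + Matrix.vecMulVec u u) v = v + (inner ℝ u v : ℝ) • u := by
  ext i
  rw [inner_eq_dotProduct]
  change ((1 + Matrix.vecMulVec u u) *ᵥ v.ofLp) i = v i + (u.ofLp ⬝ᵥ v.ofLp) * u i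
  rw [Matrix.add_mulVec, Matrix.one_mulVec, Matrix.vecMulVec_mulVec]
  simp

theorem det_one_add_vecMulVec_self (u : Vec m) (hu : ‖u‖ = 1) :
    (1 + Matrix.vecMulVec u.ofLp u.ofLp).det = 2 := by
  rw [Matrix.vecMulVec_eq Unit, Matrix.det_one_add_replicateCol_mul_replicateRow,
    ← norm_sq_eq_dotProduct, hu]
  norm_num

/-- A linear map that stretches norms at most by `c` has determinant at most `c ^ m`. -/
theorem abs_det_le_pow (M : Matrix (Fin m) (Fin m) ℝ) {c : ℝ} (hc : 0 ≤ c)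
    (h : ∀ v, ‖mulVecL M v‖ ≤ c * ‖v‖) : |M.det| ≤ c ^ m := by
  have hdet : LinearMap.det (mulVecL M) = M.det := by
    rw [mulVecL, Matrix.toEuclideanLin_eq_toLin_orthonormal, LinearMap.det_toLin]
  set μ : MeasureTheory.Measure (Vec m) := MeasureTheory.volume
  -- The image of the unit ball has |det M| times its volume and lies in a ball of radius `c`.
  have h1 := MeasureTheory.Measure.addHaar_image_linearMap μ (mulVecL M) (Metric.closedBall 0 1)
  have hsub : mulVecL M '' Metric.closedBall 0 1 ⊆ Metric.closedBall 0 c := by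
    rintro _ ⟨v, hv, rfl⟩
    rw [mem_closedBall_zero_iff] at hv ⊢
    exact (h v).trans (mul_le_of_le_one_right hc hv)
  have h2 := MeasureTheory.measure_mono (μ := μ) hsub
  rw [h1, MeasureTheory.Measure.addHaar_closedBall' μ 0 hc, hdet, finrank_euclideanSpace,
    Fintype.card_fin] at h2
  have hpos : μ (Metric.closedBall 0 1) ≠ 0 :=
    (Metric.measure_closedBall_pos μ 0 one_pos).ne'
  have hfin : μ (Metric.closedBall 0 1) ≠ ⊤ := MeasureTheory.measure_closedBall_lt_top.ne
  rw [ENNReal.mul_le_mul_iff_left hpos hfin] at h2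
  exact (ENNReal.ofReal_le_ofReal_iff (pow_nonneg hc m)).1 h2

/-- A rank-one expansion in a direction in which all columns and the point `z` are nearly
nonnegative, respectively nonpositive, keeps the image of `z` in a slightly enlarged hull of the
normalized columns. -/
theorem exists_combination_expand {a : Fin n → Vec m} (ha : ∀ j, a j ≠ 0) {u : Vec m}
    (hu : ‖u‖ = 1) {ε : ℝ} (hε : 0 ≤ ε) (hlow : ∀ j, -ε ≤ inner ℝ (hat (a j)) u)
    {c : Fin n → ℝ} (hc : ∀ j, 0 ≤ c j) (hc1 : ∑ j, c j ≤ 1)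
    (hz : inner ℝ (∑ j, c j • hat (a j)) u ≤ ε) :
    ∃ d : Fin n → ℝ, (∀ j, 0 ≤ d j) ∧ ∑ j, d j ≤ 1 ∧
      mulVecL (1 + Matrix.vecMulVec u u) (∑ j, c j • hat (a j)) =
        (1 + 3 * ε) • ∑ j, d j • hat (mulVecL (1 + Matrix.vecMulVec u u) (a j)) := by
  set Q := mulVecL (1 + Matrix.vecMulVec u u)
  have hQ : ∀ v, Q v = v + (inner ℝ u v : ℝ) • u := mulVecL_one_add_vecMulVec u
  have h3 : 0 < 1 + 3 * ε := by positivity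
  -- The weights absorb the change of column lengths. With t_j the inner product of the j-th
  -- normalized column with `u`, the new length is at most 1 + |t_j| ≤ 1 + t_j + 2ε. Weighted by the
  -- c_j, the terms t_j add up to at most ε, so the total is at most 1 + 3ε.
  refine ⟨fun j => c j * ‖Q (hat (a j))‖ / (1 + 3 * ε), fun j => ?_, ?_, ?_⟩
  · have := hc j
    positivity
  · rw [← Finset.sum_div, div_le_one h3]
    rw [sum_inner] at hz
    have hbound : ∀ j, c j * ‖Q (hat (a j))‖ ≤
        c j + inner ℝ (c j • hat (a j)) u + c j * (2 * ε) := by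
      intro j
      have hn : ‖Q (hat (a j))‖ ≤ 1 + |inner ℝ (hat (a j)) u| := by
        rw [hQ]
        refine (norm_add_le _ _).trans ?_
        rw [norm_smul, hu, mul_one, norm_hat (ha j), Real.norm_eq_abs, real_inner_comm]
      have habs : |inner ℝ (hat (a j)) u| ≤ inner ℝ (hat (a j)) u + 2 * ε := by
        have := hlow j
        rw [abs_le]
        constructor <;> linarith
      rw [inner_smul_left, RCLike.conj_to_real]
      have := mul_le_mul_of_nonneg_left (hn.trans (add_le_add_right habs 1)) (hc j)
      linarith
    have hs := Finset.sum_le_sum (fun j (_ : j ∈ Finset.univ) => hbound j)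
    rw [Finset.sum_add_distrib, Finset.sum_add_distrib, ← Finset.sum_mul] at hs
    nlinarith
  · rw [map_sum, Finset.smul_sum]
    refine Finset.sum_congr rfl fun j _ => ?_
    have hh : hat (Q (a j)) = hat (Q (hat (a j))) := by
      rw [hat.eq_1 (a j), map_smul, hat_smul (inv_pos.2 (norm_pos_iff.2 (ha j)))]
    rw [map_smul, hh, smul_smul, mul_div_cancel₀ _ h3.ne', mul_smul, norm_smul_hat]

/-! ### Bounds for admissible inputs -/

/-- The hypotheses of the algorithm on its input. -/
structure IsInput (A : Matrix (Fin m) (Fin n) ℝ) : Prop where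
  norm_col : ∀ j, ‖col A j‖ = 1
  goffin_neg : goffin A < 0

namespace IsInput

variable {A : Matrix (Fin m) (Fin n) ℝ}

theorem exists_range_ne_zero (h : IsInput A) : ∃ y ∈ LinearMap.range (mulVecL A), y ≠ 0 := by
  by_contra! hne
  have : goffin A = 0 := by
    rw [goffin]
    -- If the image is zero, the supremum is over the empty set and has the default value 0, which
    -- is not negative.
    convert Real.sSup_empty
    ext t
    simp only [Set.mem_ofPred_eq, Set.mem_empty_iff_false, iff_false]
    rintro ⟨y, hy, hy0, -⟩
    exact hy0 (hne y hy)
  exact absurd this h.goffin_neg.ne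

theorem nonempty (h : IsInput A) : Nonempty (Fin n) := by
  obtain ⟨y, ⟨x, rfl⟩, hy⟩ := h.exists_range_ne_zero
  by_contra hne
  rw [not_nonempty_iff] at hne
  exact hy (by rw [mulVecL_eq_sum, Finset.univ_eq_empty, Finset.sum_empty])

theorem col_ne_zero (h : IsInput A) (j : Fin n) : col A j ≠ 0 := by
  rw [← norm_ne_zero_iff, h.norm_col j]
  exact one_ne_zero

theorem m_pos (h : IsInput A) : 0 < m := by
  obtain ⟨j⟩ := h.nonempty
  rcases Nat.eq_zero_or_pos m with rfl | hm
  · exact absurd (Subsingleton.elim _ _) (h.col_ne_zero j)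
  · exact hm

theorem abs_goffin_pos (h : IsInput A) : 0 < |goffin A| := abs_pos.2 h.goffin_neg.ne

theorem abs_goffin_le_one (h : IsInput A) : |goffin A| ≤ 1 := by
  have := h.nonempty
  obtain ⟨y, hy, hy0⟩ := h.exists_range_ne_zero
  obtain ⟨j, hj⟩ := exists_cosAngle_le_goffin A hy hy0
  rw [abs_of_neg h.goffin_neg]
  linarith [(abs_le.1 (abs_cosAngle_le A y j)).1]

/-- A single column would have cosine 1 with itself. The bound keeps log n away from 0, so that
additive constants can be absorbed. -/
theorem two_le_n (h : IsInput A) : 2 ≤ n := by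
  obtain ⟨j⟩ := h.nonempty
  have := h.nonempty
  by_contra hn
  obtain ⟨i, hi⟩ := exists_cosAngle_le_goffin A (col_mem_range A j) (h.col_ne_zero j)
  have hij : i = j := by
    apply Fin.ext
    have := i.2
    have := j.2
    omega
  subst hij
  have h1 : cosAngle A (col A i) i = 1 := by
    rw [cosAngle, real_inner_self_eq_norm_sq, norm_hat (h.col_ne_zero i), one_pow]
  linarith [h.goffin_neg]

/-- The transpose of the input matrix shrinks no vector of the image by more than the factor
`|goffin A|`. -/
theorem abs_goffin_mul_norm_le (h : IsInput A) {w : Vec m}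
    (hw : w ∈ LinearMap.range (mulVecL A)) : |goffin A| * ‖w‖ ≤ ‖mulVecL Aᵀ w‖ := by
  have := h.nonempty
  by_cases hw0 : w = 0
  · simp [hw0]
  obtain ⟨j, hj⟩ := exists_cosAngle_le_goffin A hw hw0
  have h1 := norm_mul_cosAngle A w j
  have h2 : hat (col A j) = col A j := by rw [hat, h.norm_col j, inv_one, one_smul]
  rw [h2, ← mulVecL_transpose_apply] at h1
  have h3 := PiLp.norm_apply_le (mulVecL Aᵀ w) j
  rw [← h1, Real.norm_eq_abs, abs_mul, abs_norm] at h3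
  have h4 : |goffin A| ≤ |cosAngle A w j| := by
    rw [abs_of_neg h.goffin_neg, abs_of_neg (hj.trans_lt h.goffin_neg)]
    linarith
  calc |goffin A| * ‖w‖ = ‖w‖ * |goffin A| := mul_comm _ _
    _ ≤ ‖w‖ * |cosAngle A w j| := mul_le_mul_of_nonneg_left h4 (norm_nonneg _)
    _ ≤ _ := h3

/-- The component u = x - Πx equals `Aᵀ w` with `w` in the image, so ‖u‖² = ⟪w, A x⟫ ≤ ‖w‖ ‖A x‖,
and ‖w‖ ≤ ‖u‖ / |ρ|. -/
theorem abs_goffin_mul_norm_sub_kernelProj_le (h : IsInput A) (x : Vec n) :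
    |goffin A| * ‖x - kernelProj A x‖ ≤ ‖mulVecL A x‖ := by
  set u := x - kernelProj A x
  have hu : u ∈ (LinearMap.ker (mulVecL A))ᗮ := Submodule.sub_starProjection_mem_orthogonal x
  have hker : mulVecL A (kernelProj A x) = 0 :=
    LinearMap.mem_ker.1 (Submodule.starProjection_apply_mem (LinearMap.ker (mulVecL A)) x)
  have hAu : mulVecL A u = mulVecL A x := by rw [map_sub, hker, sub_zero]
  rw [ker_mulVecL_orthogonal] at hu
  obtain ⟨w', hw'⟩ := hu
  set V := LinearMap.range (mulVecL A)
  -- `Aᵀ` annihilates the complement of the image, so the preimage may be taken inside the image,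
  -- where the lower bound applies.
  let w := V.starProjection w'
  have hwV : w ∈ V := Submodule.starProjection_apply_mem V w'
  have hw : mulVecL Aᵀ w = u := by
    rw [← hw', ← sub_eq_zero, ← map_sub]
    apply ext_inner_right ℝ
    intro z
    rw [inner_mulVecL_transpose, inner_zero_left, ← neg_sub, inner_neg_left, neg_eq_zero]
    exact Submodule.inner_left_of_mem_orthogonal (LinearMap.mem_range_self (mulVecL A) z)
      (Submodule.sub_starProjection_mem_orthogonal w')
  have h1 := h.abs_goffin_mul_norm_le hwV
  rw [hw] at h1
  have h2 : ‖u‖ ^ 2 ≤ ‖w‖ * ‖mulVecL A x‖ := by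
    rw [← real_inner_self_eq_norm_sq]
    nth_rewrite 1 [← hw]
    rw [inner_mulVecL_transpose, hAu]
    exact real_inner_le_norm _ _
  by_cases hu0 : ‖u‖ = 0
  · rw [hu0, mul_zero]; exact norm_nonneg _
  · have hpos : 0 < ‖u‖ := lt_of_le_of_ne (norm_nonneg _) (Ne.symm hu0)
    have h3 := mul_le_mul_of_nonneg_left h2 (abs_nonneg (goffin A))
    have h4 := mul_le_mul_of_nonneg_right h1 (norm_nonneg (mulVecL A x))
    nlinarith

end IsInput

theorem eps_pos (hm : 0 < m) : 0 < eps m := by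
  rw [eps]
  positivity

theorem eps_le (hm : 0 < m) : eps m ≤ 1 / 11 := by
  rw [eps]
  have : (1 : ℝ) ≤ m := by exact_mod_cast hm
  apply one_div_le_one_div_of_le <;> linarith

/-- Here the constant 11 matters: over all `m` dimensions, one rescaling enlarges the hull by a
logarithmic volume of at most 3/11, well below the log 2 gained by the determinant. -/
theorem eps_mul (hm : 0 < m) : (m : ℝ) * (3 * eps m) = 3 / 11 := by
  rw [eps]
  have : (m : ℝ) ≠ 0 := by exact_mod_cast hm.ne'
  field_simp

/-! ### The invariant of the algorithm -/

/-- What is known of a state `s` that is reached from the input `A` by `R` rescalings and `D`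
Dunagan-Vempala updates. -/
structure Inv (A : Matrix (Fin m) (Fin n) ℝ) (s : KState m n) (R D : ℕ) : Prop where
  y_eq : s.y = mulVecL s.A s.x
  one_le : ∀ j, 1 ≤ s.x j
  norm_y : ‖s.y‖ ^ 2 ≤ (n : ℝ) ^ 2 * 4 ^ R * (1 - eps m ^ 2) ^ D
  -- `M` is the product of all expansions so far. Being trivial off the image, it has the
  -- determinant of its restriction to the image, so rank-deficient inputs need no separate
  -- treatment.
  exists_expansion : ∃ M : Matrix (Fin m) (Fin m) ℝ, s.A = M * A ∧ M.det = 2 ^ R ∧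
    (∀ v, ‖v‖ ≤ ‖mulVecL M v‖) ∧
    (∀ v ∈ LinearMap.range (mulVecL A), mulVecL M v ∈ LinearMap.range (mulVecL A)) ∧
    (∀ v ∈ (LinearMap.range (mulVecL A))ᗮ, mulVecL M v = v) ∧
    ∀ v ∈ LinearMap.range (mulVecL A), ‖v‖ ≤ |goffin A| →
      ∃ c : Fin n → ℝ, (∀ j, 0 ≤ c j) ∧ ∑ j, c j ≤ 1 ∧
        mulVecL M v = (1 + 3 * eps m) ^ R • ∑ j, c j • hat (col s.A j)

namespace Inv

variable {A : Matrix (Fin m) (Fin n) ℝ} {s : KState m n} {R D : ℕ}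

theorem init (h : IsInput A) : Inv A (initState A) 0 0 where
  y_eq := rfl
  one_le j := le_rfl
  norm_y := by
    have h1 : ‖(initState A).y‖ ≤ n := by
      change ‖mulVecL A _‖ ≤ _
      rw [mulVecL_eq_sum]
      refine (norm_sum_le _ _).trans ?_
      simp [h.norm_col]
    simpa using pow_le_pow_left₀ (norm_nonneg _) h1 2
  exists_expansion := by
    have := h.nonempty
    have h1 : ∀ v : Vec m, mulVecL (1 : Matrix (Fin m) (Fin m) ℝ) v = v := fun v => by
      ext i
      exact congrFun (Matrix.one_mulVec v.ofLp) i
    refine ⟨1, (Matrix.one_mul _).symm, by simp, fun v => by rw [h1], fun v hv => by rwa [h1],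
      fun v _ => h1 v, fun v hv hle => ?_⟩
    obtain ⟨c, hc0, hc1, hc⟩ := exists_convexCombination h.goffin_neg hv hle
    refine ⟨c, hc0, hc1.le, ?_⟩
    rw [h1, pow_zero, one_smul]
    exact hc

theorem col_ne_zero (hs : Inv A s R D) (h : IsInput A) (j : Fin n) : col s.A j ≠ 0 := by
  obtain ⟨M, hM, -, hn, -⟩ := hs.exists_expansion
  have := hn (col A j)
  rw [h.norm_col j, ← col_mul, ← hM] at this
  rw [← norm_pos_iff]
  linarith

theorem y_mem_range (hs : Inv A s R D) : s.y ∈ LinearMap.range (mulVecL A) := by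
  obtain ⟨M, hM, -, -, hV, -⟩ := hs.exists_expansion
  rw [hs.y_eq, hM, mulVecL_mul]
  exact hV _ ⟨_, rfl⟩

/-- Unless the exit test succeeds, the vector `y` is not short. -/
theorem abs_goffin_le_norm_y (hs : Inv A s R D) (h : IsInput A) (ht : ¬ Terminal A s) :
    |goffin A| ≤ ‖s.y‖ := by
  by_contra! hlt
  refine ht fun j => ?_
  obtain ⟨M, hM, -, hn, -⟩ := hs.exists_expansion
  have h1 := hn (mulVecL A s.x)
  rw [← mulVecL_mul, ← hM, ← hs.y_eq] at h1
  have h2 := (h.abs_goffin_mul_norm_sub_kernelProj_le s.x).trans h1 |>.trans_lt hlt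
  -- Projecting moves each coordinate by less than 1, and all coordinates of `x` are at least 1.
  have h3 : ‖s.x - kernelProj A s.x‖ < 1 := by
    by_contra! h4
    nlinarith [h.abs_goffin_pos]
  have h4 := (PiLp.norm_apply_le (s.x - kernelProj A s.x) j).trans_lt h3
  rw [PiLp.sub_apply, Real.norm_eq_abs, abs_lt] at h4
  linarith [hs.one_le j]

theorem y_ne_zero (hs : Inv A s R D) (h : IsInput A) (ht : ¬ Terminal A s) : s.y ≠ 0 := by
  rw [← norm_pos_iff]
  exact h.abs_goffin_pos.trans_le (hs.abs_goffin_le_norm_y h ht)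

/-- The hull of the normalized columns lies in the unit ball, so `M` stretches the image by at most
(1 + 3ε)^R / |ρ|. This factor is at least 1, hence by Pythagoras it also bounds `M` on the whole
space, and the determinant is bounded by its m-th power. -/
theorem two_pow_le (hs : Inv A s R D) (h : IsInput A) :
    (2 : ℝ) ^ R ≤ ((1 + 3 * eps m) ^ R / |goffin A|) ^ m := by
  obtain ⟨M, hM, hdet, -, hV, hperp, hcomb⟩ := hs.exists_expansion
  set V := LinearMap.range (mulVecL A)
  set K : ℝ := (1 + 3 * eps m) ^ R
  set c := K / |goffin A|
  have hε := eps_pos h.m_pos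
  have hρ := h.abs_goffin_pos
  have hK : 1 ≤ K := one_le_pow₀ (by linarith)
  have hc : 1 ≤ c := (one_le_div hρ).2 (h.abs_goffin_le_one.trans hK)
  have hball : ∀ v ∈ V, ‖v‖ ≤ |goffin A| → ‖mulVecL M v‖ ≤ K := by
    intro v hv hle
    obtain ⟨d, hd0, hd1, hd⟩ := hcomb v hv hle
    rw [hd, norm_smul, Real.norm_of_nonneg (by positivity)]
    refine mul_le_of_le_one_right (by positivity) ((norm_sum_le _ _).trans (le_trans ?_ hd1))
    refine Finset.sum_le_sum fun j _ => ?_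
    rw [norm_smul, Real.norm_of_nonneg (hd0 j)]
    exact mul_le_of_le_one_right (hd0 j) (norm_hat_le _)
  have hVn : ∀ v ∈ V, ‖mulVecL M v‖ ≤ c * ‖v‖ := by
    intro v hv
    by_cases hv0 : v = 0
    · simp [hv0]
    have hpos := norm_pos_iff.2 hv0
    have h1 := hball ((|goffin A| / ‖v‖) • v) (V.smul_mem _ hv) (by
      rw [norm_smul, Real.norm_of_nonneg (by positivity), div_mul_cancel₀ _ hpos.ne'])
    rw [map_smul, norm_smul, Real.norm_of_nonneg (by positivity), div_mul_eq_mul_div,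
      div_le_iff₀ hpos] at h1
    rw [div_mul_eq_mul_div, le_div_iff₀ hρ]
    linarith
  have hall : ∀ v, ‖mulVecL M v‖ ≤ c * ‖v‖ := by
    intro v
    set p := V.starProjection v
    set q := v - p with hq
    have hp : p ∈ V := Submodule.starProjection_apply_mem V v
    have hqV : q ∈ Vᗮ := Submodule.sub_starProjection_mem_orthogonal v
    have hv : v = p + q := by rw [hq]; abel
    have h1 : ‖mulVecL M v‖ ^ 2 = ‖mulVecL M p‖ ^ 2 + ‖q‖ ^ 2 := by
      rw [hv, map_add, hperp q hqV, sq, sq, sq]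
      exact norm_add_sq_eq_norm_sq_add_norm_sq_of_inner_eq_zero _ _
        (Submodule.inner_right_of_mem_orthogonal (hV p hp) hqV)
    have h2 : ‖v‖ ^ 2 = ‖p‖ ^ 2 + ‖q‖ ^ 2 := by
      rw [hv, sq, sq, sq]
      exact norm_add_sq_eq_norm_sq_add_norm_sq_of_inner_eq_zero _ _
        (Submodule.inner_right_of_mem_orthogonal hp hqV)
    have h3 := pow_le_pow_left₀ (norm_nonneg _) (hVn p hp) 2
    have h4 : 1 ≤ c ^ 2 := one_le_pow₀ hc
    refine le_of_sq_le_sq ?_ (by positivity)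
    rw [mul_pow, h1, h2]
    rw [mul_pow] at h3
    nlinarith [sq_nonneg ‖q‖]
  have := abs_det_le_pow M (by linarith) hall
  rwa [hdet, abs_of_pos (by positivity)] at this

/-- The number of rescalings. -/
theorem rescale_count_le (hs : Inv A s R D) (h : IsInput A) :
    (R : ℝ) ≤ 3 * m * Real.log |goffin A|⁻¹ := by
  have hε := eps_pos h.m_pos
  have hρ := h.abs_goffin_pos
  have h1 := Real.log_le_log (by positivity) (hs.two_pow_le h)
  rw [Real.log_pow, Real.log_pow, div_eq_mul_inv, Real.log_mul (by positivity) (by positivity),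
    Real.log_pow] at h1
  have h2 : Real.log (1 + 3 * eps m) ≤ 3 * eps m := by
    have := Real.log_le_sub_one_of_pos (show 0 < 1 + 3 * eps m by positivity)
    linarith
  have h3 : (m : ℝ) * (R * Real.log (1 + 3 * eps m)) ≤ R * (3 / 11) := by
    rw [← eps_mul h.m_pos, mul_left_comm]
    gcongr
  have h4 := Real.log_two_gt_d9
  -- The factor 3 in the claim comes from 0.69 - 3/11 > 1/3.
  have h5 : (R : ℝ) * 0.69 ≤ R * Real.log 2 := by
    gcongr
    linarith
  have h6 : (0 : ℝ) ≤ R := R.cast_nonneg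
  nlinarith

theorem dv_step_norm {y b : Vec m} (hb : ‖b‖ = 1) :
    ‖y - (inner ℝ b y : ℝ) • b‖ ^ 2 = ‖y‖ ^ 2 - (inner ℝ b y : ℝ) ^ 2 := by
  rw [norm_sub_sq_real, inner_smul_right, norm_smul, hb, real_inner_comm, Real.norm_eq_abs, mul_one,
    sq_abs]
  ring

theorem norm_dvUpdate_y (k : Fin n) (hk : col s.A k ≠ 0) :
    ‖(dvUpdate s k).y‖ ^ 2 = ‖s.y‖ ^ 2 * (1 - cosAngle s.A s.y k ^ 2) := by
  change ‖s.y - (inner ℝ (hat (col s.A k)) s.y : ℝ) • hat (col s.A k)‖ ^ 2 = _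
  rw [dv_step_norm (norm_hat hk), ← norm_mul_cosAngle]
  ring

theorem smul_hat_col (k : Fin n) :
    (inner ℝ (hat (col s.A k)) s.y : ℝ) • hat (col s.A k) =
      (inner ℝ (col s.A k) s.y / ‖col s.A k‖ ^ 2) • col s.A k := by
  rw [hat, inner_smul_left, smul_smul, RCLike.conj_to_real]
  congr 1
  rw [div_eq_mul_inv, ← inv_pow]
  ring

theorem dv (hs : Inv A s R D) (h : IsInput A) {k : Fin n} (hk : cosAngle s.A s.y k < -eps m) :
    Inv A (dvUpdate s k) R (D + 1) where
  y_eq := by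
    change s.y - (inner ℝ (hat (col s.A k)) s.y : ℝ) • hat (col s.A k) =
      mulVecL s.A (s.x - (inner ℝ (col s.A k) s.y / ‖col s.A k‖ ^ 2) •
        EuclideanSpace.single k (1 : ℝ))
    rw [smul_hat_col, map_sub, map_smul, mulVecL_single, ← hs.y_eq]
  one_le j := by
    have hε := eps_pos h.m_pos
    -- The chosen column has negative cosine with `y`, so the update can only increase `x`.
    have hneg : (inner ℝ (col s.A k) s.y : ℝ) ≤ 0 := by
      rw [← norm_smul_hat (col s.A k), inner_smul_left, ← norm_mul_cosAngle, RCLike.conj_to_real]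
      refine mul_nonpos_of_nonneg_of_nonpos (norm_nonneg _)
        (mul_nonpos_of_nonneg_of_nonpos (norm_nonneg _) (by linarith))
    have hc : inner ℝ (col s.A k) s.y / ‖col s.A k‖ ^ 2 ≤ 0 :=
      div_nonpos_of_nonpos_of_nonneg hneg (by positivity)
    change 1 ≤ s.x j - (inner ℝ (col s.A k) s.y / ‖col s.A k‖ ^ 2) *
      (EuclideanSpace.single k (1 : ℝ)) j
    have hone : 0 ≤ (EuclideanSpace.single k (1 : ℝ)) j := by
      rw [PiLp.single_apply]
      split_ifs <;> norm_num
    nlinarith [hs.one_le j]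
  norm_y := by
    have hε := eps_pos h.m_pos
    rw [norm_dvUpdate_y k (hs.col_ne_zero h k), pow_succ (_ : ℝ) D, ← mul_assoc]
    have h1 := (abs_le.1 (abs_cosAngle_le s.A s.y k)).1
    refine mul_le_mul hs.norm_y ?_ ?_ ((sq_nonneg _).trans hs.norm_y) <;> nlinarith
  exists_expansion := hs.exists_expansion

theorem norm_expand_sq {u : Vec m} (hu : ‖u‖ = 1) (v : Vec m) :
    ‖mulVecL (1 + Matrix.vecMulVec u u) v‖ ^ 2 = ‖v‖ ^ 2 + 3 * (inner ℝ u v : ℝ) ^ 2 := by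
  rw [mulVecL_one_add_vecMulVec, norm_add_sq_real, inner_smul_right, norm_smul, hu,
    real_inner_comm, Real.norm_eq_abs, mul_one, sq_abs]
  ring

theorem expand_self {u : Vec m} (hu : ‖u‖ = 1) :
    mulVecL (1 + Matrix.vecMulVec u u) u = (2 : ℝ) • u := by
  rw [mulVecL_one_add_vecMulVec, real_inner_self_eq_norm_sq, hu, one_pow, one_smul, two_smul]

theorem rescale (hs : Inv A s R D) (h : IsInput A) (ht : ¬ Terminal A s)
    (hk : ∀ j, -eps m ≤ cosAngle s.A s.y j) : Inv A (rescale s) (R + 1) D where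
  y_eq := by
    have hu := norm_hat (hs.y_ne_zero h ht)
    change (2 : ℝ) • s.y = mulVecL ((1 + Matrix.vecMulVec (hat s.y) (hat s.y)) * s.A) s.x
    rw [mulVecL_mul, ← hs.y_eq]
    conv_rhs => rw [← norm_smul_hat s.y]
    -- The preceding rewriting also changed the `y` inside `hat`; this and the next lines undo that,
    -- so that ŷ is seen to be an eigenvector with eigenvalue 2.
    rw [hat_smul (norm_pos_iff.2 (hs.y_ne_zero h ht))]
    have : hat (hat s.y) = hat s.y := by
      rw [hat.eq_1 s.y, hat_smul (inv_pos.2 (norm_pos_iff.2 (hs.y_ne_zero h ht))), hat.eq_1]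
    rw [this, map_smul, expand_self hu, smul_comm, norm_smul_hat]
  one_le := hs.one_le
  norm_y := by
    change ‖(2 : ℝ) • s.y‖ ^ 2 ≤ _
    rw [norm_smul, mul_pow, Real.norm_of_nonneg zero_le_two, pow_succ (4 : ℝ)]
    have := hs.norm_y
    linarith
  exists_expansion := by
    obtain ⟨M, hM, hdet, hn, hV, hperp, hcomb⟩ := hs.exists_expansion
    have hε := eps_pos h.m_pos
    have hu := norm_hat (hs.y_ne_zero h ht)
    set u := hat s.y
    set Q := 1 + Matrix.vecMulVec u u
    have huV : u ∈ LinearMap.range (mulVecL A) := Submodule.smul_mem _ _ hs.y_mem_range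
    have hA : (KernelAlg.rescale s).A = Q * s.A := rfl
    refine ⟨Q * M, ?_, ?_, ?_, ?_, ?_, ?_⟩
    · rw [hA, hM, Matrix.mul_assoc]
    · rw [Matrix.det_mul, det_one_add_vecMulVec_self u hu, hdet, pow_succ']
    · intro v
      rw [mulVecL_mul]
      refine (hn v).trans (le_of_sq_le_sq ?_ (norm_nonneg _))
      rw [norm_expand_sq hu]
      nlinarith [sq_nonneg (inner ℝ u (mulVecL M v) : ℝ)]
    · intro v hv
      rw [mulVecL_mul, mulVecL_one_add_vecMulVec]
      exact Submodule.add_mem _ (hV v hv) (Submodule.smul_mem _ _ huV)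
    · intro v hv
      rw [mulVecL_mul, hperp v hv, mulVecL_one_add_vecMulVec,
        Submodule.inner_right_of_mem_orthogonal huV hv, zero_smul, add_zero]
    · intro v hv hle
      obtain ⟨c, hc0, hc1, hc⟩ := hcomb v hv hle
      -- The ball is symmetric: writing the image of `-v` as a combination of columns with cosine at
      -- least -ε bounds the image of `v` from above in the direction of `y`.
      obtain ⟨c', hc0', hc1', hc'⟩ := hcomb (-v) (Submodule.neg_mem _ hv) (by rwa [norm_neg])
      have hK : (0 : ℝ) < (1 + 3 * eps m) ^ R := by positivity
      have hneg : ∑ j, c j • hat (col s.A j) = -∑ j, c' j • hat (col s.A j) := by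
        rw [map_neg, hc, ← smul_neg] at hc'
        have := smul_right_injective _ hK.ne' hc'
        rw [← this, neg_neg]
      have hup : inner ℝ (∑ j, c j • hat (col s.A j)) u ≤ eps m := by
        rw [hneg, inner_neg_left, sum_inner, neg_le]
        calc -eps m ≤ ∑ j, c' j * -eps m := by
              rw [← Finset.sum_mul]; nlinarith
          _ ≤ _ := Finset.sum_le_sum fun j _ => by
              rw [inner_smul_left, RCLike.conj_to_real]
              exact mul_le_mul_of_nonneg_left (hk j) (hc0' j)
      obtain ⟨d, hd0, hd1, hd⟩ :=
        exists_combination_expand (hs.col_ne_zero h) hu hε.le hk hc0 hc1 hup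
      refine ⟨d, hd0, hd1, ?_⟩
      rw [mulVecL_mul, hc, map_smul, hd, smul_smul, ← pow_succ]
      simp only [hA, col_mul, Q]

/-- The number of Dunagan-Vempala updates. -/
theorem dv_count_le (hs : Inv A s R D) (h : IsInput A) (ht : ¬ Terminal A s) :
    (D : ℝ) ≤ 242 * ((m : ℝ) ^ 2 * Real.log n) + 968 * (m : ℝ) ^ 3 * Real.log |goffin A|⁻¹ := by
  have hm : (1 : ℝ) ≤ m := by exact_mod_cast h.m_pos
  have hn : (2 : ℝ) ≤ n := by exact_mod_cast h.two_le_n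
  have hε := eps_pos h.m_pos
  have hε' := eps_le h.m_pos
  have hρ := h.abs_goffin_pos
  have hpos : 0 < 1 - eps m ^ 2 := by nlinarith
  have h1 := (pow_le_pow_left₀ hρ.le (hs.abs_goffin_le_norm_y h ht) 2).trans hs.norm_y
  have h2 := Real.log_le_log (by positivity) h1
  rw [Real.log_mul (by positivity) (by positivity), Real.log_mul (by positivity) (by positivity),
    Real.log_pow, Real.log_pow, Real.log_pow, Real.log_pow] at h2
  have h3 := Real.log_le_sub_one_of_pos hpos
  have h4 : (D : ℝ) * Real.log (1 - eps m ^ 2) ≤ D * -eps m ^ 2 := by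
    gcongr
    linarith
  have h5 : Real.log 4 ≤ 2 := by
    rw [show (4 : ℝ) = 2 ^ 2 by norm_num, Real.log_pow]
    have := Real.log_two_lt_d9
    push_cast
    linarith
  have h6 := hs.rescale_count_le h
  have h7 : (R : ℝ) * Real.log 4 ≤ 2 * R := by
    rw [mul_comm]
    gcongr
  set ℓ := Real.log |goffin A|⁻¹ with hℓ
  have hℓ' : Real.log |goffin A| = -ℓ := by rw [hℓ, Real.log_inv, neg_neg]
  have hℓ0 : 0 ≤ ℓ := Real.log_nonneg ((one_le_inv₀ hρ).2 h.abs_goffin_le_one)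
  rw [hℓ'] at h2
  push_cast at h2
  -- Taking logarithms of ρ² ≤ n² 4^R (1 - ε²)^D leaves 2 log n + 2ℓ + 2R, where R ≤ 3mℓ and m ≥ 1.
  have h8 : (D : ℝ) * eps m ^ 2 ≤ 2 * Real.log n + 8 * m * ℓ := by
    nlinarith
  have h9 : eps m ^ 2 * (121 * (m : ℝ) ^ 2) = 1 := by
    rw [eps]
    field_simp
    norm_num
  calc (D : ℝ) = (D * eps m ^ 2) * (121 * (m : ℝ) ^ 2) := by rw [mul_assoc, h9, mul_one]
    _ ≤ (2 * Real.log n + 8 * m * ℓ) * (121 * (m : ℝ) ^ 2) := by gcongr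
    _ = _ := by ring

end Inv

/-! ### Well-conditioned inputs -/

/-- What is known, for inputs whose Goffin measure is at most `-1/2`, of the state after `t`
Dunagan-Vempala updates: no rescaling occurs and `y` shrinks geometrically. -/
structure FastInv (A : Matrix (Fin m) (Fin n) ℝ) (s : KState m n) (t : ℕ) : Prop where
  A_eq : s.A = A
  norm_y : ‖s.y‖ ^ 2 ≤ (n : ℝ) ^ 2 * (3 / 4) ^ t

namespace FastInv

variable {A : Matrix (Fin m) (Fin n) ℝ} {s : KState m n} {R D t : ℕ}

/-- As the matrix is still the input, the Goffin measure itself bounds the smallest cosine, which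
lies far below -ε; this rules out a rescaling. -/
theorem cosAngle_le (hs : FastInv A s t) (hi : Inv A s R D) (h : IsInput A)
    (ht : ¬ Terminal A s) (hρ : 1 / 2 ≤ |goffin A|) {k : Fin n}
    (hk : ∀ j, cosAngle s.A s.y k ≤ cosAngle s.A s.y j) : cosAngle s.A s.y k ≤ -(1 / 2) := by
  have := h.nonempty
  obtain ⟨j, hj⟩ := exists_cosAngle_le_goffin A hi.y_mem_range (hi.y_ne_zero h ht)
  rw [abs_of_neg h.goffin_neg] at hρ
  have := hk j
  rw [hs.A_eq] at this ⊢
  linarith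

theorem dv (hs : FastInv A s t) (hi : Inv A s R D) (h : IsInput A) {k : Fin n}
    (hk : cosAngle s.A s.y k ≤ -(1 / 2)) : FastInv A (dvUpdate s k) (t + 1) where
  A_eq := hs.A_eq
  norm_y := by
    rw [Inv.norm_dvUpdate_y k (hi.col_ne_zero h k), pow_succ (_ : ℝ) t, ← mul_assoc]
    have h1 := (abs_le.1 (abs_cosAngle_le s.A s.y k)).1
    refine mul_le_mul hs.norm_y ?_ ?_ ((sq_nonneg _).trans hs.norm_y) <;> nlinarith

theorem count_le (hs : FastInv A s t) (hi : Inv A s R D) (h : IsInput A)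
    (ht : ¬ Terminal A s) (hρ : 1 / 2 ≤ |goffin A|) : (t : ℝ) ≤ 16 * Real.log n := by
  have hn : (2 : ℝ) ≤ n := by exact_mod_cast h.two_le_n
  have h1 : (1 / 2 : ℝ) ^ 2 ≤ (n : ℝ) ^ 2 * (3 / 4) ^ t :=
    (pow_le_pow_left₀ (by norm_num) (hρ.trans (hi.abs_goffin_le_norm_y h ht)) 2).trans hs.norm_y
  have h2 := Real.log_le_log (by positivity) h1
  rw [Real.log_mul (by positivity) (by positivity), Real.log_pow, Real.log_pow, Real.log_pow,
    one_div, Real.log_inv] at h2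
  have h3 : Real.log (3 / 4) ≤ -(1 / 4) := by
    have := Real.log_le_sub_one_of_pos (show (0 : ℝ) < 3 / 4 by norm_num)
    linarith
  have h4 : (t : ℝ) * Real.log (3 / 4) ≤ t * -(1 / 4) := by gcongr
  have h5 : Real.log 2 ≤ Real.log n := Real.log_le_log (by norm_num) hn
  push_cast at h2
  linarith

end FastInv

/-! ### Executions -/

theorem dvCount_zero (s : ℕ → KState m n) : dvCount s 0 = 0 := by
  simp [dvCount]

theorem dvCount_succ_of_exists {s : ℕ → KState m n} {t : ℕ}
    (h : ∃ k, cosAngle (s t).A (s t).y k < -eps m) : dvCount s (t + 1) = dvCount s t + 1 := by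
  rw [dvCount, dvCount, ← Set.ncard_insert_of_notMem (a := t) (by simp)
    ((Set.finite_lt_nat t).subset fun _ hi => hi.1)]
  congr 1
  ext i
  simp only [Set.mem_ofPred_eq, Set.mem_insert_iff, Nat.lt_succ_iff_lt_or_eq]
  constructor
  · rintro ⟨hi | hi, hk⟩
    · exact Or.inr ⟨hi, hk⟩
    · exact Or.inl hi
  · rintro (rfl | ⟨hi, hk⟩)
    · exact ⟨Or.inr rfl, h⟩
    · exact ⟨Or.inl hi, hk⟩

theorem dvCount_succ_of_not_exists {s : ℕ → KState m n} {t : ℕ}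
    (h : ¬ ∃ k, cosAngle (s t).A (s t).y k < -eps m) : dvCount s (t + 1) = dvCount s t := by
  rw [dvCount, dvCount]
  congr 1
  ext i
  simp only [Set.mem_ofPred_eq, Nat.lt_succ_iff_lt_or_eq]
  constructor
  · rintro ⟨hi | rfl, hk⟩
    · exact ⟨hi, hk⟩
    · exact absurd hk h
  · rintro ⟨hi, hk⟩
    exact ⟨Or.inl hi, hk⟩

namespace IsExecution

variable {A : Matrix (Fin m) (Fin n) ℝ} {s : ℕ → KState m n}

theorem exists_inv (hs : IsExecution A s) (h : IsInput A) : ∀ t : ℕ,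
    (∀ i < t, ¬ Terminal A (s i)) → ∃ R, R + dvCount s t = t ∧ Inv A (s t) R (dvCount s t)
  | 0, _ => ⟨0, by rw [dvCount_zero], by rw [dvCount_zero, hs.1]; exact Inv.init h⟩
  | t + 1, ht => by
    obtain ⟨R, hR, hinv⟩ := exists_inv hs h t fun i hi => ht i (hi.trans t.lt_succ_self)
    have hterm := ht t t.lt_succ_self
    have hstep := hs.2 t hterm
    generalize hs' : s (t + 1) = s' at hstep
    cases hstep with
    | dv k hmin hk =>
      rw [dvCount_succ_of_exists ⟨k, hk⟩]
      exact ⟨R, by omega, hinv.dv h hk⟩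
    | rescale k hmin hk =>
      rw [dvCount_succ_of_not_exists fun ⟨j, hj⟩ => hk ((hmin j).trans_lt hj)]
      exact ⟨R + 1, by omega, hinv.rescale h hterm fun j => (not_lt.1 hk).trans (hmin j)⟩

theorem fastInv (hs : IsExecution A s) (h : IsInput A) (hρ : 1 / 2 ≤ |goffin A|) : ∀ t : ℕ,
    (∀ i < t, ¬ Terminal A (s i)) → FastInv A (s t) t
  | 0, _ => by
    rw [hs.1]
    exact ⟨rfl, by simpa using (Inv.init h).norm_y⟩
  | t + 1, ht => by
    have ht' : ∀ i < t, ¬ Terminal A (s i) := fun i hi => ht i (hi.trans t.lt_succ_self)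
    have hfast := fastInv hs h hρ t ht'
    obtain ⟨R, -, hinv⟩ := exists_inv hs h t ht'
    have hterm := ht t t.lt_succ_self
    have hstep := hs.2 t hterm
    generalize hs' : s (t + 1) = s' at hstep
    cases hstep with
    | dv k hmin hk => exact hfast.dv hinv h (hfast.cosAngle_le hinv h hterm hρ hmin)
    | rescale k hmin hk =>
      have := hfast.cosAngle_le hinv h hterm hρ hmin
      have := eps_le h.m_pos
      exact absurd (by linarith) hk

/-- Each pass is a DV update or a rescaling. Both numbers are bounded as long as the exit test
fails, so it cannot fail forever. -/
theorem exists_haltsAt (hs : IsExecution A s) (h : IsInput A) : ∃ T, HaltsAt A s T := by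
  classical
  by_cases hT : ∃ T, Terminal A (s T)
  · exact ⟨Nat.find hT, Nat.find_spec hT, fun t ht => Nat.find_min hT ht⟩
  exfalso
  push Not at hT
  obtain ⟨t, ht⟩ := exists_nat_gt (3 * m * Real.log |goffin A|⁻¹ +
    (242 * ((m : ℝ) ^ 2 * Real.log n) + 968 * (m : ℝ) ^ 3 * Real.log |goffin A|⁻¹))
  obtain ⟨R, hR, hinv⟩ := hs.exists_inv h t fun i _ => hT i
  have h1 := hinv.rescale_count_le h
  have h2 := hinv.dv_count_le h (hT t)
  have h3 : (R : ℝ) + dvCount s t = t := by exact_mod_cast hR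
  linarith

/-- The potential argument applies to the last state that fails the exit test. One more update may
follow; since 1 ≤ 2 m² log n, it raises 242 to 244. -/
theorem dvCount_le (hs : IsExecution A s) (h : IsInput A) {T : ℕ} (hT : HaltsAt A s T) :
    (dvCount s T : ℝ) ≤
      244 * ((m : ℝ) ^ 2 * Real.log n) + 968 * (m : ℝ) ^ 3 * Real.log |goffin A|⁻¹ := by
  have hm : (1 : ℝ) ≤ m := by exact_mod_cast h.m_pos
  have hn : (2 : ℝ) ≤ n := by exact_mod_cast h.two_le_n
  have hlog : 1 / 2 ≤ Real.log n :=
    (by linarith [Real.log_two_gt_d9] : (1 / 2 : ℝ) ≤ Real.log 2).trans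
      (Real.log_le_log (by norm_num) hn)
  have hℓ : 0 ≤ Real.log |goffin A|⁻¹ :=
    Real.log_nonneg ((one_le_inv₀ h.abs_goffin_pos).2 h.abs_goffin_le_one)
  cases T with
  | zero =>
    rw [dvCount_zero, Nat.cast_zero]
    positivity
  | succ t =>
    obtain ⟨R, -, hinv⟩ := hs.exists_inv h t fun i hi => hT.2 i (hi.trans t.lt_succ_self)
    have h1 := hinv.dv_count_le h (hT.2 t t.lt_succ_self)
    have h2 : dvCount s (t + 1) ≤ dvCount s t + 1 := by
      by_cases hk : ∃ k, cosAngle (s t).A (s t).y k < -eps m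
      · rw [dvCount_succ_of_exists hk]
      · rw [dvCount_succ_of_not_exists hk]
        exact Nat.le_succ _
    have h3 : (dvCount s (t + 1) : ℝ) ≤ dvCount s t + 1 := by exact_mod_cast h2
    have h4 : (1 : ℝ) ≤ (m : ℝ) ^ 2 := one_le_pow₀ hm
    nlinarith

theorem halt_le_of_half_le (hs : IsExecution A s) (h : IsInput A) {T : ℕ} (hT : HaltsAt A s T)
    (hρ : 1 / 2 ≤ |goffin A|) : (T : ℝ) ≤ 18 * Real.log n := by
  have hn : (2 : ℝ) ≤ n := by exact_mod_cast h.two_le_n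
  have hlog : 1 / 2 ≤ Real.log n :=
    (by linarith [Real.log_two_gt_d9] : (1 / 2 : ℝ) ≤ Real.log 2).trans
      (Real.log_le_log (by norm_num) hn)
  cases T with
  | zero =>
    rw [Nat.cast_zero]
    positivity
  | succ t =>
    have ht' : ∀ i < t, ¬ Terminal A (s i) := fun i hi => hT.2 i (hi.trans t.lt_succ_self)
    obtain ⟨R, -, hinv⟩ := hs.exists_inv h t ht'
    have h1 := (hs.fastInv h hρ t ht').count_le hinv h (hT.2 t t.lt_succ_self) hρ
    push_cast
    linarith

end IsExecution

/-! ### The implementation follows an execution -/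

/-- The signed square preserves the order of cosines, so both the choice of `k` and the comparison
with -ε avoid square roots. -/
theorem mul_abs_strictMono : StrictMono fun c : ℝ => c * |c| := by
  intro a b hab
  simp only
  rcases le_total 0 a with ha | ha <;> rcases le_total 0 b with hb | hb
  · rw [abs_of_nonneg ha, abs_of_nonneg hb]; nlinarith
  · linarith
  · rw [abs_of_nonpos ha, abs_of_nonneg hb]
    rcases ha.lt_or_eq with ha' | rfl
    · nlinarith
    · nlinarith
  · rw [abs_of_nonpos ha, abs_of_nonpos hb]; nlinarith

theorem signedSq_inner {A : Matrix (Fin m) (Fin n) ℝ} {y : Vec m} {j : Fin n}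
    (ha : col A j ≠ 0) (hy : y ≠ 0) :
    (Prog.signedSq (inner ℝ (col A j) y) (‖col A j‖ ^ 2)).run.1 =
      ‖y‖ ^ 2 * (cosAngle A y j * |cosAngle A y j|) := by
  have ha' := norm_pos_iff.2 ha
  have hy' := norm_pos_iff.2 hy
  have hin : (inner ℝ (col A j) y : ℝ) = ‖col A j‖ * (‖y‖ * cosAngle A y j) := by
    rw [norm_mul_cosAngle]
    nth_rewrite 1 [← norm_smul_hat (col A j)]
    rw [inner_smul_left, RCLike.conj_to_real]
  rw [Prog.signedSq_fst, hin]
  have hneg : ‖col A j‖ * (‖y‖ * cosAngle A y j) < 0 ↔ cosAngle A y j < 0 := by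
    rw [mul_neg_iff, mul_neg_iff]
    simp [ha', hy', ha'.not_gt, hy'.not_gt]
  simp only [hneg]
  split_ifs with h
  · rw [abs_of_neg h]; field_simp
  · rw [abs_of_nonneg (not_lt.1 h)]; field_simp

/-- The residue is orthogonal to all rows, hence in the kernel, and what was subtracted lies in the
row space, hence is orthogonal to the kernel. These two properties determine the projection. -/
theorem project_eq_kernelProj (A : Matrix (Fin m) (Fin n) ℝ) (v : Vec n) :
    (Prog.project (Prog.gramSchmidt (List.ofFn fun i j => A i j)).run.1 v.ofLp).run.1 =
      (kernelProj A v).ofLp := by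
  obtain ⟨h1, h2, -⟩ := Prog.gramSchmidt_spec (List.ofFn fun i j => A i j)
  have h3 := Prog.sub_project_mem (Prog.gramSchmidt (List.ofFn fun i j => A i j)).run.1 v.ofLp
  have h4 := Prog.project_dotProduct_eq_zero _ v.ofLp h1
  set p := (Prog.project (Prog.gramSchmidt (List.ofFn fun i j => A i j)).run.1 v.ofLp).run.1
  have h5 : ∀ q ∈ Prog.listSpan (Prog.gramSchmidt (List.ofFn fun i j => A i j)).run.1,
      p ⬝ᵥ q = 0 := by
    intro q hq
    induction hq using Submodule.span_induction with
    | mem q hq =>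
      obtain ⟨r, hr, rfl⟩ := hq
      exact h4 r hr
    | zero => exact dotProduct_zero _
    | add q r _ _ hq hr => rw [dotProduct_add, hq, hr, add_zero]
    | smul c q _ hq => rw [dotProduct_smul, hq, smul_zero]
  rw [h2] at h3 h5
  have hker : WithLp.toLp 2 p ∈ LinearMap.ker (mulVecL A) := by
    rw [LinearMap.mem_ker]
    ext i
    rw [mulVecL_apply, dotProduct_comm]
    exact h5 _ (Submodule.subset_span (List.mem_ofFn.2 ⟨i, rfl⟩))
  have horth : v - WithLp.toLp 2 p ∈ (LinearMap.ker (mulVecL A))ᗮ := by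
    rw [Submodule.mem_orthogonal']
    intro z hz
    rw [inner_eq_dotProduct]
    change (v.ofLp - p) ⬝ᵥ z.ofLp = 0
    generalize v.ofLp - p = q at h3
    induction h3 using Submodule.span_induction with
    | mem q hq =>
      obtain ⟨i, rfl⟩ := List.mem_ofFn.1 hq
      exact congrFun (congrArg WithLp.ofLp (LinearMap.mem_ker.1 hz)) i
    | zero => exact zero_dotProduct _
    | add q r _ _ hq hr => rw [add_dotProduct, hq, hr, add_zero]
    | smul c q _ hq => rw [smul_dotProduct, hq, smul_zero]
  rw [kernelProj, Submodule.eq_starProjection_of_mem_orthogonal hker horth]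

/-- The memory state `w` represents the state `s` of the algorithm on the input `A₀`. -/
structure Represents (A₀ : Matrix (Fin m) (Fin n) ℝ) (w : Prog.Work ℝ m n) (s : KState m n) :
    Prop where
  project : ∀ v : Vec n, (Prog.project w.basis v.ofLp).run.1 = (kernelProj A₀ v).ofLp
  length_le : w.basis.length ≤ m
  A_eq : ∀ i j, w.A i j = s.A i j
  x_eq : w.x = s.x.ofLp
  y_eq : s.y = mulVecL s.A s.x
  eta_eq : w.eta = ‖s.y‖ ^ 2
  z_eq : ∀ j, w.z j = inner ℝ (col s.A j) s.y
  sq_eq : ∀ j, w.sq j = ‖col s.A j‖ ^ 2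
  xbar_eq : w.xbar = (kernelProj A₀ s.x).ofLp
  cache_eq : ∀ k p, w.cache k = some p → (∀ j, p.1 j = inner ℝ (col s.A j) (col s.A k)) ∧
    p.2 = (kernelProj A₀ (EuclideanSpace.single k (1 : ℝ))).ofLp

/-- The number of cached columns. -/
def cached (w : Prog.Work ℝ m n) : ℕ :=
  (Finset.univ.filter fun k => (w.cache k).isSome).card

theorem cached_le (w : Prog.Work ℝ m n) : cached w ≤ n :=
  (Finset.card_filter_le _ _).trans (by simp)

theorem represents_initWork (A : Matrix (Fin m) (Fin n) ℝ) :
    Represents A (Prog.initWork fun i j => A i j).run.1 (initState A) := by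
  constructor
  · simp only [Prog.initWork, Prog.run_bind_fst, Prog.run_pure]
    exact project_eq_kernelProj A
  · simpa [Prog.initWork] using (Prog.gramSchmidt_spec (List.ofFn fun i j => A i j)).2.2
  · intro i j
    simp [Prog.initWork, initState]
  · simp [Prog.initWork, initState]
  · rfl
  · rw [norm_sq_eq_dotProduct]
    simp only [Prog.initWork, Prog.run_bind_fst, Prog.run_pure, Prog.tabulate_fst, Prog.dot_fst,
      Prog.run_num, Nat.cast_one]
    rfl
  · intro j
    rw [inner_eq_dotProduct]
    simp only [Prog.initWork, Prog.run_bind_fst, Prog.run_pure, Prog.tabulate_fst, Prog.dot_fst,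
      Prog.run_num, Nat.cast_one]
    rfl
  · intro j
    rw [norm_sq_eq_dotProduct]
    simp only [Prog.initWork, Prog.run_bind_fst, Prog.run_pure, Prog.tabulate_fst, Prog.dot_fst]
    rfl
  · rw [← project_eq_kernelProj]
    simp only [Prog.initWork, Prog.run_bind_fst, Prog.run_pure, Prog.tabulate_fst, Prog.run_num,
      Nat.cast_one]
    rfl
  · intro k p hp
    simp [Prog.initWork] at hp

theorem cached_initWork (A : Fin m → Fin n → ℝ) : cached (Prog.initWork A).run.1 = 0 := by
  simp [cached, Prog.initWork]

theorem initWork_snd_le (hm : 0 < m) (hn : 0 < n) (A : Fin m → Fin n → ℝ) :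
    (Prog.initWork A).run.2 ≤ 30 * m ^ 2 * n := by
  have h1 := Prog.gramSchmidt_snd_le (List.ofFn A)
  have h2 := Prog.tabulate_snd_le (α := ℝ) (c := 1) n (fun _ => Prog.num 1) (fun _ => le_rfl)
  have h3 := (Prog.gramSchmidt_spec (List.ofFn A)).2.2
  have h4 : ∀ x : Fin n → ℝ, (Prog.tabulate m fun i => Prog.dot (A i) x).run.2 ≤ m * (2 * n + 1) :=
    fun x => Prog.tabulate_snd_le m _ (fun i => (Prog.dot_snd _ _).le)
  have h5 : ∀ y : Fin m → ℝ,
      (Prog.tabulate n fun j => Prog.dot (fun i => A i j) y).run.2 ≤ n * (2 * m + 1) :=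
    fun x => Prog.tabulate_snd_le n _ (fun i => (Prog.dot_snd _ _).le)
  have h6 : (Prog.tabulate n fun j => Prog.dot (fun i => A i j) fun i => A i j).run.2 ≤
      n * (2 * m + 1) := Prog.tabulate_snd_le n _ (fun i => (Prog.dot_snd _ _).le)
  have h7 : ∀ x : Fin n → ℝ, (Prog.project (Prog.gramSchmidt (List.ofFn A)).run.1 x).run.2 ≤
      m * (4 * n + 2) := fun x =>
    (Prog.project_snd_le _ x).trans (Nat.mul_le_mul_right _ (h3.trans (by simp)))
  simp only [List.length_ofFn] at h1
  simp only [Prog.initWork, Prog.run_bind_snd, Prog.run_pure, Prog.dot_snd]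
  refine (add_le_add h1 (add_le_add h2 (add_le_add (h4 _) (add_le_add le_rfl
    (add_le_add (h5 _) (add_le_add h6 (add_le_add (h7 _) le_rfl))))))).trans ?_
  have a1 : m * n ≤ m ^ 2 * n := Nat.mul_le_mul_right n (Nat.le_self_pow two_ne_zero m)
  have a2 : m ^ 2 ≤ m ^ 2 * n := Nat.le_mul_of_pos_right _ hn
  have a3 : m ≤ m ^ 2 := Nat.le_self_pow two_ne_zero m
  have a4 : n ≤ m * n := Nat.le_mul_of_pos_left _ hm
  nlinarith

theorem fetch_fst {A₀ : Matrix (Fin m) (Fin n) ℝ} {w : Prog.Work ℝ m n} {s : KState m n}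
    (hw : Represents A₀ w s) (k : Fin n) :
    (∀ j, (Prog.fetch w k).run.1.1 j = inner ℝ (col s.A j) (col s.A k)) ∧
      (Prog.fetch w k).run.1.2 = (kernelProj A₀ (EuclideanSpace.single k (1 : ℝ))).ofLp := by
  rw [Prog.fetch.eq_def]
  split
  · next p hp => exact hw.cache_eq k p hp
  · simp only [Prog.run_bind_fst, Prog.run_pure, Prog.tabulate_fst, Prog.dot_fst]
    refine ⟨fun j => ?_, ?_⟩
    · rw [inner_eq_dotProduct]
      simp only [hw.A_eq]
      rfl
    · rw [← hw.project]
      congr 3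
      funext j
      rw [PiLp.single_apply]
      split_ifs <;> simp

theorem fetch_snd_le {A₀ : Matrix (Fin m) (Fin n) ℝ} {w : Prog.Work ℝ m n} {s : KState m n}
    (hw : Represents A₀ w s) (hm : 0 < m) (hn : 0 < n) (k : Fin n) :
    (Prog.fetch w k).run.2 ≤ if (w.cache k).isSome then 0 else 10 * m * n := by
  rw [Prog.fetch.eq_def]
  split
  · next p hp => simp
  · next hp =>
    have h1 : (Prog.tabulate n fun j => Prog.dot (fun i => w.A i j) fun i => w.A i k).run.2 ≤
        n * (2 * m + 1) := Prog.tabulate_snd_le n _ (fun i => (Prog.dot_snd _ _).le)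
    have h2 : (Prog.tabulate n fun j => if j = k then Prog.num (R := ℝ) 1 else Prog.num 0).run.2 ≤
        n * 1 := Prog.tabulate_snd_le n _ (fun i => by split_ifs <;> simp)
    have h3 : ∀ x, (Prog.project w.basis x).run.2 ≤ m * (4 * n + 2) := fun x =>
      (Prog.project_snd_le _ x).trans (Nat.mul_le_mul_right _ hw.length_le)
    simp only [Prog.run_bind_snd, Prog.run_pure, hp, Option.isSome_none, Bool.false_eq_true,
      if_false]
    refine (add_le_add h1 (add_le_add h2 (add_le_add (h3 _) le_rfl))).trans ?_
    have a1 : m ≤ m * n := Nat.le_mul_of_pos_right _ hn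
    have a2 : n ≤ m * n := Nat.le_mul_of_pos_left _ hm
    nlinarith

/-- All stored quantities depend on `x` linearly or, in the case of ‖y‖², quadratically. One column
of the Gram matrix and one of the projection matrix therefore suffice for the update. -/
theorem represents_dvWork {A₀ : Matrix (Fin m) (Fin n) ℝ} {w : Prog.Work ℝ m n} {s : KState m n}
    (hw : Represents A₀ w s) {k : Fin n} (hk : col s.A k ≠ 0) :
    Represents A₀ (Prog.dvWork w k).run.1 (dvUpdate s k) := by
  obtain ⟨hf1, hf2⟩ := fetch_fst hw k
  have hz := hw.z_eq k
  have hsq := hw.sq_eq k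
  have hpos := norm_pos_iff.2 hk
  have hy : (dvUpdate s k).y =
      s.y - (inner ℝ (col s.A k) s.y / ‖col s.A k‖ ^ 2) • col s.A k := by
    rw [← Inv.smul_hat_col]
    rfl
  constructor
  · simp only [Prog.dvWork, Prog.run_bind_fst, Prog.run_pure]
    exact hw.project
  · simp only [Prog.dvWork, Prog.run_bind_fst, Prog.run_pure]
    exact hw.length_le
  · simp only [Prog.dvWork, Prog.run_bind_fst, Prog.run_pure]
    exact hw.A_eq
  · simp only [Prog.dvWork, Prog.run_bind_fst, Prog.run_pure, Prog.run_minus, Prog.run_quot, hz,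
      hsq, hw.x_eq]
    funext j
    change _ = s.x j - (inner ℝ (col s.A k) s.y / ‖col s.A k‖ ^ 2) *
      (EuclideanSpace.single k (1 : ℝ)) j
    rw [PiLp.single_apply]
    by_cases hj : j = k
    · subst hj; simp
    · simp [hj]
  · rw [hy]
    change _ = mulVecL s.A (s.x - (inner ℝ (col s.A k) s.y / ‖col s.A k‖ ^ 2) •
        EuclideanSpace.single k (1 : ℝ))
    rw [map_sub, map_smul, mulVecL_single, ← hw.y_eq]
  · simp only [Prog.dvWork, Prog.run_bind_fst, Prog.run_pure, Prog.run_minus, Prog.run_quot,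
      Prog.run_times, hz, hsq, hw.eta_eq]
    rw [hy, norm_sub_sq_real, inner_smul_right, norm_smul, mul_pow, Real.norm_eq_abs, sq_abs,
      real_inner_comm]
    field_simp
    ring
  · intro j
    simp only [Prog.dvWork, Prog.run_bind_fst, Prog.run_pure, Prog.run_quot, Prog.subMul_fst, hz,
      hsq]
    rw [hy, inner_sub_right, inner_smul_right]
    simp only [Pi.sub_apply, Pi.smul_apply, smul_eq_mul, hf1, hw.z_eq j]
    rfl
  · simp only [Prog.dvWork, Prog.run_bind_fst, Prog.run_pure]
    exact hw.sq_eq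
  · simp only [Prog.dvWork, Prog.run_bind_fst, Prog.run_pure, Prog.run_quot, Prog.subMul_fst, hz,
      hsq, hf2, hw.xbar_eq]
    change _ = (kernelProj A₀ (s.x - (inner ℝ (col s.A k) s.y / ‖col s.A k‖ ^ 2) •
        EuclideanSpace.single k (1 : ℝ))).ofLp
    rw [kernelProj, kernelProj, kernelProj, map_sub, map_smul]
    rfl
  · intro j p hp
    simp only [Prog.dvWork, Prog.run_bind_fst, Prog.run_pure] at hp
    by_cases hj : j = k
    · subst hj
      rw [Function.update_self, Option.some_inj] at hp
      subst hp
      exact ⟨hf1, hf2⟩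
    · rw [Function.update_of_ne hj] at hp
      exact hw.cache_eq j p hp

theorem cached_dvWork (w : Prog.Work ℝ m n) (k : Fin n) :
    cached (Prog.dvWork w k).run.1 = cached w + if (w.cache k).isSome then 0 else 1 := by
  have hset : (Finset.univ.filter fun j => ((Prog.dvWork w k).run.1.cache j).isSome) =
      insert k (Finset.univ.filter fun j => (w.cache j).isSome) := by
    ext j
    simp only [Prog.dvWork, Prog.run_bind_fst, Prog.run_pure, Finset.mem_filter, Finset.mem_univ,
      true_and, Finset.mem_insert]
    by_cases hj : j = k
    · subst hj; simp
    · simp [hj]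
  rw [cached, hset, cached]
  split_ifs with h
  · rw [Finset.insert_eq_of_mem (by simpa using h), add_zero]
  · rw [Finset.card_insert_of_notMem (by simpa using h)]

/-- Amortized form: the growth of the cache pays for a column that is computed for the first time.
-/
theorem dvWork_snd_le {A₀ : Matrix (Fin m) (Fin n) ℝ} {w : Prog.Work ℝ m n} {s : KState m n}
    (hw : Represents A₀ w s) (hm : 0 < m) (hn : 0 < n) (k : Fin n) :
    (Prog.dvWork w k).run.2 + 10 * m * n * cached w ≤
      8 * n + 10 * m * n * cached (Prog.dvWork w k).run.1 := by
  have h1 := fetch_snd_le hw hm hn k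
  have h2 : (Prog.dvWork w k).run.2 ≤ (Prog.fetch w k).run.2 + 8 * n := by
    simp only [Prog.dvWork, Prog.run_bind_snd, Prog.run_pure, Prog.run_quot, Prog.run_minus,
      Prog.run_times]
    have a1 := Prog.subMul_snd_le w.z (w.z k / w.sq k) (Prog.fetch w k).run.1.1
    have a2 := Prog.subMul_snd_le w.xbar (w.z k / w.sq k) (Prog.fetch w k).run.1.2
    omega
  rw [cached_dvWork]
  split_ifs at h1 ⊢ <;> linarith

theorem represents_rescaleWork {A₀ : Matrix (Fin m) (Fin n) ℝ} {w : Prog.Work ℝ m n}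
    {s : KState m n} (hw : Represents A₀ w s) (hy : s.y ≠ 0) :
    Represents A₀ (Prog.rescaleWork w).run.1 (rescale s) := by
  have hpos := norm_pos_iff.2 hy
  have hu := norm_hat hy
  have hin : ∀ a : Vec m, (inner ℝ (hat s.y) a : ℝ) = inner ℝ a s.y / ‖s.y‖ := fun a => by
    rw [hat, inner_smul_left, RCLike.conj_to_real, real_inner_comm, div_eq_inv_mul]
  have huy : (inner ℝ (hat s.y) s.y : ℝ) = ‖s.y‖ := by
    rw [hin, real_inner_self_eq_norm_sq]
    field_simp
  have hcol : ∀ j, col (rescale s).A j =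
      col s.A j + (inner ℝ (col s.A j) s.y / ‖s.y‖) • hat s.y := fun j => by
    rw [← hin, ← mulVecL_one_add_vecMulVec, ← col_mul]
    rfl
  -- For a unit vector u the square of I + uuᵀ is I + 3uuᵀ.
  have hgram : ∀ j k, (inner ℝ (col (rescale s).A j) (col (rescale s).A k) : ℝ) =
      inner ℝ (col s.A j) (col s.A k) +
        3 * inner ℝ (col s.A j) s.y / ‖s.y‖ ^ 2 * inner ℝ (col s.A k) s.y := fun j k => by
    rw [hcol, hcol, inner_add_left, inner_add_right, inner_add_right, inner_smul_left,
      inner_smul_left, inner_smul_right, inner_smul_right, real_inner_self_eq_norm_sq, hu,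
      real_inner_comm (hat s.y) (col s.A j), hin, hin, RCLike.conj_to_real]
    field_simp
    ring
  have hyw : ∀ i, (w.A i ⬝ᵥ w.x) = s.y i := fun i => by
    have := funext (hw.A_eq i)
    rw [this, hw.x_eq, hw.y_eq]
    rfl
  constructor
  · simp only [Prog.rescaleWork, Prog.run_bind_fst, Prog.run_pure]
    exact hw.project
  · simp only [Prog.rescaleWork, Prog.run_bind_fst, Prog.run_pure]
    exact hw.length_le
  · intro i j
    simp only [Prog.rescaleWork, Prog.run_bind_fst, Prog.run_pure, Prog.run_quot, Prog.addMul_fst,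
      Prog.tabulate_fst, Prog.dot_fst, hyw, hw.eta_eq, Pi.add_apply, Pi.smul_apply, smul_eq_mul,
      hw.A_eq, hw.z_eq]
    rw [← col_apply (rescale s).A, hcol]
    simp only [hat, PiLp.add_apply, PiLp.smul_apply, smul_eq_mul, col_apply]
    field_simp
  · simp only [Prog.rescaleWork, Prog.run_bind_fst, Prog.run_pure]
    exact hw.x_eq
  · change (2 : ℝ) • s.y = mulVecL ((1 + Matrix.vecMulVec (hat s.y) (hat s.y)) * s.A) s.x
    rw [mulVecL_mul, ← hw.y_eq, mulVecL_one_add_vecMulVec, huy, norm_smul_hat, two_smul]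
  · simp only [Prog.rescaleWork, Prog.run_bind_fst, Prog.run_pure, Prog.run_times, Prog.run_num,
      hw.eta_eq]
    change _ = ‖(2 : ℝ) • s.y‖ ^ 2
    rw [norm_smul, mul_pow]
    norm_num
  · intro j
    simp only [Prog.rescaleWork, Prog.run_bind_fst, Prog.run_pure, Prog.run_times, Prog.run_num,
      Prog.tabulate_fst, hw.z_eq]
    rw [hcol]
    change _ = inner ℝ _ ((2 : ℝ) • s.y)
    rw [inner_smul_right, inner_add_left, inner_smul_left, huy, RCLike.conj_to_real]
    field_simp
    norm_num
    ring
  · intro j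
    rw [← real_inner_self_eq_norm_sq, hgram, real_inner_self_eq_norm_sq]
    simp only [Prog.rescaleWork, Prog.run_bind_fst, Prog.run_pure, Prog.run_times, Prog.run_num,
      Prog.tabulate_fst, Prog.run_quot, Prog.run_plus, hw.z_eq, hw.sq_eq, hw.eta_eq,
      Nat.cast_ofNat]
  · simp only [Prog.rescaleWork, Prog.run_bind_fst, Prog.run_pure]
    exact hw.xbar_eq
  · intro k p hp
    simp only [Prog.rescaleWork, Prog.run_bind_fst, Prog.run_pure, Prog.tabulate_fst] at hp
    split at hp
    · simp at hp
    · next q hq =>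
      obtain ⟨h1, h2⟩ := hw.cache_eq k q hq
      simp only [Prog.run_bind_fst, Prog.run_pure, Option.some_inj, Prog.addMul_fst,
        Prog.run_times, Prog.run_quot, Prog.run_num] at hp
      subst hp
      refine ⟨fun j => ?_, h2⟩
      rw [hgram, real_inner_comm]
      simp only [Pi.add_apply, Pi.smul_apply, smul_eq_mul, h1, hw.z_eq, hw.eta_eq, Nat.cast_ofNat]
      rw [real_inner_comm]
      ring

theorem cached_rescaleWork (w : Prog.Work ℝ m n) :
    cached (Prog.rescaleWork w).run.1 = cached w := by
  rw [cached, cached]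
  congr 2
  funext k
  simp only [Prog.rescaleWork, Prog.run_bind_fst, Prog.run_pure, Prog.tabulate_fst]
  split
  · next h => simp [h]
  · next h => simp [h]

/-- The term n² is the price of correcting up to `n` cached Gram columns. -/
theorem rescaleWork_snd_le (hm : 0 < m) (hn : 0 < n) (w : Prog.Work ℝ m n) :
    (Prog.rescaleWork w).run.2 ≤ 14 * m * n + 2 * n ^ 2 := by
  have hcost : (Prog.rescaleWork w).run.2 ≤ m * (2 * n + 1) + (m * (1 + n * 2) + (1 + (1 +
      (n * 2 + (n * 2 + (n * (n * 2) + (1 + (n * 1 + 0)))))))) := by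
    simp only [Prog.rescaleWork, Prog.run_bind_snd, Prog.run_pure, Prog.run_num, Prog.run_times]
    refine add_le_add (Prog.tabulate_snd_le m _ fun i => ?_) (add_le_add
      (Prog.tabulate_snd_le m _ fun i => ?_) (add_le_add le_rfl (add_le_add le_rfl
      (add_le_add (Prog.tabulate_snd_le n _ fun i => ?_) (add_le_add
      (Prog.tabulate_snd_le n _ fun i => ?_) (add_le_add (Prog.tabulate_snd_le n _ fun i => ?_)
      (add_le_add le_rfl (add_le_add (Prog.tabulate_snd_le n _ fun i => ?_) le_rfl))))))))
    · exact (Prog.dot_snd _ _).le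
    · simp only [Prog.run_bind_snd, Prog.run_quot]
      exact add_le_add le_rfl (Prog.addMul_snd_le _ _ _)
    · simp
    · simp
    · split
      · simp
      · simp only [Prog.run_bind_snd, Prog.run_pure, add_zero]
        exact Prog.addMul_snd_le _ _ _
    · simp
  refine hcost.trans ?_
  have a1 : m ≤ m * n := Nat.le_mul_of_pos_right _ hn
  have a2 : n ≤ m * n := Nat.le_mul_of_pos_left _ hm
  nlinarith

/-! ### One pass through the loop -/

theorem loopBody_of_terminal {A₀ : Matrix (Fin m) (Fin (n + 1)) ℝ}
    {w : Prog.Work ℝ m (n + 1)} {s : KState m (n + 1)} (hw : Represents A₀ w s)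
    (ht : Terminal A₀ s) :
    (Prog.loopBody w).run.1 = Sum.inr w ∧ (Prog.loopBody w).run.2 ≤ 2 * (n + 1) := by
  have hdone : (Prog.allPos w.xbar).run.1 = true := by
    rw [Prog.allPos_fst, hw.xbar_eq]
    exact ht
  have h2 := Prog.allPos_snd_le w.xbar
  constructor
  · simp only [Prog.loopBody, Prog.run_bind_fst, hdone, if_true, Prog.run_pure]
  · simpa only [Prog.loopBody, Prog.run_bind_snd, hdone, if_true, Prog.run_pure,
      add_zero] using h2

/-- One pass through the loop: the implementation in memory state `w` and the algorithm in state
`s` proceed to `w'` and `s'`, at the stated costs. -/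
structure Pass (w : Prog.Work ℝ m (n + 1)) (s : KState m (n + 1)) (w' : Prog.Work ℝ m (n + 1))
    (s' : KState m (n + 1)) : Prop where
  run_eq : (Prog.loopBody w).run.1 = Sum.inl w'
  iteration : Iteration s s'
  cost : (∃ k, cosAngle s.A s.y k < -eps m) ∧ cached w' ≤ cached w + 1 ∧
      (Prog.loopBody w).run.2 + 10 * m * (n + 1) * cached w ≤
        21 * (n + 1) + 10 * m * (n + 1) * cached w' ∨
    (¬ ∃ k, cosAngle s.A s.y k < -eps m) ∧ cached w' = cached w ∧
      (Prog.loopBody w).run.2 ≤ 27 * m * (n + 1) + 2 * (n + 1) ^ 2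

theorem exists_pass {A₀ : Matrix (Fin m) (Fin (n + 1)) ℝ} {w : Prog.Work ℝ m (n + 1)}
    {s : KState m (n + 1)} (hm : 0 < m) (hw : Represents A₀ w s) (ht : ¬ Terminal A₀ s)
    (hcol : ∀ j, col s.A j ≠ 0) (hy : s.y ≠ 0) :
    ∃ w' s', Pass w s w' s' ∧ Represents A₀ w' s' := by
  have hdone : (Prog.allPos w.xbar).run.1 = false := by
    rw [← Bool.not_eq_true, Prog.allPos_fst, hw.xbar_eq]
    exact ht
  have hdone_cost := Prog.allPos_snd_le w.xbar
  have hypos : 0 < ‖s.y‖ ^ 2 := by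
    have := norm_pos_iff.2 hy
    positivity
  have hε := eps_pos hm
  have hkeys : ∀ j, (Prog.signedSq (w.z j) (w.sq j)).run.1 =
      ‖s.y‖ ^ 2 * (cosAngle s.A s.y j * |cosAngle s.A s.y j|) := fun j => by
    rw [hw.z_eq, hw.sq_eq, signedSq_inner (hcol j) hy]
  have hkeys_cost := Prog.tabulate_snd_le (n + 1) (fun j => Prog.signedSq (w.z j) (w.sq j))
    fun j => Prog.signedSq_snd_le _ _
  have harg := Prog.argmin_fst (Prog.tabulate (n + 1) fun j =>
    Prog.signedSq (w.z j) (w.sq j)).run.1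
  have harg_cost := Prog.argmin_snd (Prog.tabulate (n + 1) fun j =>
    Prog.signedSq (w.z j) (w.sq j)).run.1
  set r := (Prog.argmin (Prog.tabulate (n + 1) fun j =>
    Prog.signedSq (w.z j) (w.sq j)).run.1).run.1 with hr
  simp only [Prog.tabulate_fst, hkeys] at harg
  obtain ⟨h2, hmin⟩ := harg
  have hmin' : ∀ j, cosAngle s.A s.y r.1 ≤ cosAngle s.A s.y j := fun j =>
    mul_abs_strictMono.le_iff_le.1 (le_of_mul_le_mul_left (hmin j) hypos)
  -- Since 121 m² = ε⁻², this compares the signed squares of the cosine and of -ε after scaling both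
  -- by ‖y‖² / ε².
  have htest : ((121 * m ^ 2 : ℕ) : ℝ) * r.2 < ((0 : ℕ) : ℝ) - w.eta ↔
      cosAngle s.A s.y r.1 < -eps m := by
    rw [h2, hw.eta_eq, ← mul_abs_strictMono.lt_iff_lt (b := -eps m), abs_neg, abs_of_pos hε]
    have h9 : eps m ^ 2 * (121 * (m : ℝ) ^ 2) = 1 := by
      have : (m : ℝ) ≠ 0 := by exact_mod_cast hm.ne'
      rw [eps]
      field_simp
      norm_num
    have hm' : (0 : ℝ) < 121 * (m : ℝ) ^ 2 := by positivity
    have e1 : ((121 * m ^ 2 : ℕ) : ℝ) * (‖s.y‖ ^ 2 *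
        (cosAngle s.A s.y r.1 * |cosAngle s.A s.y r.1|)) =
        (121 * (m : ℝ) ^ 2 * ‖s.y‖ ^ 2) * (cosAngle s.A s.y r.1 * |cosAngle s.A s.y r.1|) := by
      push_cast
      ring
    have e2 : ((0 : ℕ) : ℝ) - ‖s.y‖ ^ 2 =
        (121 * (m : ℝ) ^ 2 * ‖s.y‖ ^ 2) * (-eps m * eps m) := by
      rw [Nat.cast_zero]
      linear_combination ‖s.y‖ ^ 2 * h9
    rw [e1, e2]
    exact mul_lt_mul_iff_right₀ (mul_pos hm' hypos)
  by_cases hk : cosAngle s.A s.y r.1 < -eps m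
  · have hb : decide (((121 * m ^ 2 : ℕ) : ℝ) * r.2 < ((0 : ℕ) : ℝ) - w.eta) = true :=
      decide_eq_true (htest.2 hk)
    refine ⟨(Prog.dvWork w r.1).run.1, dvUpdate s r.1, ⟨?_, .dv r.1 hmin' hk, Or.inl
      ⟨⟨_, hk⟩, ?_, ?_⟩⟩, represents_dvWork hw (hcol _)⟩
    · simp only [Prog.loopBody, Prog.run_bind_fst, hdone, Bool.false_eq_true, if_false,
        Prog.run_num, Prog.run_times, Prog.run_minus, Prog.run_lt, ← hr, hb, if_true,
        Prog.run_pure]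
    · rw [cached_dvWork]
      split_ifs <;> omega
    · have h3 := dvWork_snd_le hw hm n.succ_pos r.1
      have h4 : (Prog.loopBody w).run.2 ≤ 13 * (n + 1) + (Prog.dvWork w r.1).run.2 := by
        simp only [Prog.loopBody, Prog.run_bind_snd, hdone, Bool.false_eq_true,
          if_false, Prog.run_num, Prog.run_times, Prog.run_minus, Prog.run_lt, ← hr, hb, if_true,
          Prog.run_pure, harg_cost]
        omega
      linarith
  · have hb : decide (((121 * m ^ 2 : ℕ) : ℝ) * r.2 < ((0 : ℕ) : ℝ) - w.eta) = false :=
      decide_eq_false (fun h => hk (htest.1 h))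
    refine ⟨(Prog.rescaleWork w).run.1, rescale s, ⟨?_, .rescale r.1 hmin' hk, Or.inr
      ⟨?_, cached_rescaleWork w, ?_⟩⟩, represents_rescaleWork hw hy⟩
    · simp only [Prog.loopBody, Prog.run_bind_fst, hdone, Bool.false_eq_true, if_false,
        Prog.run_num, Prog.run_times, Prog.run_minus, Prog.run_lt, ← hr, hb, Prog.run_pure]
    · rintro ⟨j, hj⟩
      exact hk ((hmin' j).trans_lt hj)
    · have h3 := rescaleWork_snd_le hm n.succ_pos w
      have h4 : (Prog.loopBody w).run.2 ≤ 13 * (n + 1) + (Prog.rescaleWork w).run.2 := by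
        simp only [Prog.loopBody, Prog.run_bind_snd, hdone, Bool.false_eq_true,
          if_false, Prog.run_num, Prog.run_times, Prog.run_minus, Prog.run_lt, ← hr, hb,
          Prog.run_pure, harg_cost]
        omega
      have a2 : n + 1 ≤ m * (n + 1) := Nat.le_mul_of_pos_left _ hm
      simp only [Nat.succ_eq_add_one] at h3
      linarith

/-! ### The whole run and its cost -/

theorem whileRun_eq {σ τ : Type} (body : σ → Prog ℝ (σ ⊕ τ)) (o : τ) : ∀ (T : ℕ) (w : ℕ → σ),
    (∀ t < T, (body (w t)).run.1 = Sum.inl (w (t + 1))) → (body (w T)).run.1 = Sum.inr o →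
    whileRun body (T + 1) (w 0) =
      some (o, ∑ t ∈ Finset.range T, (body (w t)).run.2 + (body (w T)).run.2)
  | 0, w, _, h => by
    rw [whileRun, show (body (w 0)).run = (Sum.inr o, (body (w 0)).run.2) from
      Prod.ext h rfl]
    simp
  | T + 1, w, h, h' => by
    have ih := whileRun_eq body o T (fun t => w (t + 1)) (fun t ht => h (t + 1) (by omega)) h'
    rw [whileRun, show (body (w 0)).run = (Sum.inl (w 1), (body (w 0)).run.2) from
      Prod.ext (h 0 T.succ_pos) rfl]
    simp only [zero_add] at ih
    simp only [ih, Option.map_some, Finset.sum_range_succ' _ T]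
    congr 2
    omega

/-- The implementation and an execution of the algorithm that it follows. -/
theorem exists_simulation {A : Matrix (Fin m) (Fin (n + 1)) ℝ} (h : IsInput A) :
    ∃ (s : ℕ → KState m (n + 1)) (w : ℕ → Prog.Work ℝ m (n + 1)), IsExecution A s ∧
      w 0 = (Prog.initWork fun i j => A i j).run.1 ∧ (∀ t, Represents A (w t) (s t)) ∧
      ∀ t, ¬ Terminal A (s t) → Pass (w t) (s t) (w (t + 1)) (s (t + 1)) := by
  -- The invariant is carried along because a pass needs nonzero columns and a nonzero `y`. A
  -- terminal pair is simply repeated.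
  let P : Prog.Work ℝ m (n + 1) × KState m (n + 1) → Prop := fun q =>
    Represents A q.1 q.2 ∧ ∃ R D, Inv A q.2 R D
  have hstep : ∀ q : {q // P q}, ∃ q' : {q // P q},
      ¬ Terminal A q.1.2 → Pass q.1.1 q.1.2 q'.1.1 q'.1.2 := by
    rintro ⟨⟨w, s⟩, hw, R, D, hinv⟩
    by_cases ht : Terminal A s
    · exact ⟨⟨⟨w, s⟩, hw, R, D, hinv⟩, fun h' => absurd ht h'⟩
    · obtain ⟨w', s', hpass, hw'⟩ :=
        exists_pass h.m_pos hw ht (hinv.col_ne_zero h) (hinv.y_ne_zero h ht)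
      have hinv' : ∃ R D, Inv A s' R D := by
        have hi := hpass.iteration
        cases hi with
        | dv k hmin hk => exact ⟨R, D + 1, hinv.dv h hk⟩
        | rescale k hmin hk =>
          exact ⟨R + 1, D, hinv.rescale h ht fun j => (not_lt.1 hk).trans (hmin j)⟩
      exact ⟨⟨⟨w', s'⟩, hw', hinv'⟩, fun _ => hpass⟩
  choose next hnext using hstep
  let q : ℕ → {q // P q} := fun t => Nat.rec
    ⟨⟨(Prog.initWork fun i j => A i j).run.1, initState A⟩, represents_initWork A, 0, 0,
      Inv.init h⟩ (fun _ q => next q) t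
  exact ⟨fun t => (q t).1.2, fun t => (q t).1.1, ⟨rfl, fun t ht => (hnext (q t) ht).iteration⟩,
    rfl, fun t => (q t).2.1, fun t ht => hnext (q t) ht⟩

/-- The amortized costs telescope: the cache size at the end accounts for all first uses, and
rescalings leave it unchanged. -/
theorem sum_cost_le {A : Matrix (Fin m) (Fin (n + 1)) ℝ} {s : ℕ → KState m (n + 1)}
    {w : ℕ → Prog.Work ℝ m (n + 1)} (h0 : cached (w 0) = 0)
    (hpass : ∀ t, ¬ Terminal A (s t) → Pass (w t) (s t) (w (t + 1)) (s (t + 1))) : ∀ T : ℕ,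
    (∀ t < T, ¬ Terminal A (s t)) → ∀ R, R + dvCount s T = T →
      cached (w T) ≤ dvCount s T ∧
      ∑ t ∈ Finset.range T, (Prog.loopBody (w t)).run.2 ≤ 21 * (n + 1) * dvCount s T +
        10 * m * (n + 1) * cached (w T) + (27 * m * (n + 1) + 2 * (n + 1) ^ 2) * R
  | 0, _, R, hR => by simp [h0]
  | T + 1, hT, R, hR => by
    have ih := sum_cost_le h0 hpass T (fun t ht => hT t (ht.trans T.lt_succ_self))
    rw [Finset.sum_range_succ]
    rcases (hpass T (hT T T.lt_succ_self)).cost with ⟨hk, h1, h2⟩ | ⟨hk, h1, h2⟩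
    · rw [dvCount_succ_of_exists hk] at hR ⊢
      obtain ⟨h3, h4⟩ := ih R (by omega)
      refine ⟨by omega, ?_⟩
      linarith
    · rw [dvCount_succ_of_not_exists hk] at hR ⊢
      have hle : dvCount s T ≤ T := by
        refine (Set.ncard_le_ncard (t := Set.Iio T) (fun _ hi => hi.1) (Set.finite_Iio T)).trans ?_
        rw [← Finset.coe_Iio, Set.ncard_coe_finset, Nat.card_Iio]
      obtain ⟨R', rfl⟩ : ∃ R', R = R' + 1 := ⟨R - 1, by omega⟩
      obtain ⟨h3, h4⟩ := ih R' (by omega)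
      refine ⟨by omega, ?_⟩
      rw [h1]
      linarith

/-- The total number of operations of the implementation. -/
theorem implementation_cost_le {A : Matrix (Fin m) (Fin (n + 1)) ℝ} (h : IsInput A)
    {s : ℕ → KState m (n + 1)} (hs : IsExecution A s) {T : ℕ} (hT : HaltsAt A s T)
    {R F cost : ℕ} (hR : (R : ℝ) ≤ 3 * m * Real.log |goffin A|⁻¹) (hF : F ≤ n + 1)
    (hFT : F ≤ T)
    (hcost : cost ≤ 30 * m ^ 2 * (n + 1) + (21 * (n + 1) * dvCount s T +
      10 * m * (n + 1) * F + (27 * m * (n + 1) + 2 * (n + 1) ^ 2) * R + 2 * (n + 1))) :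
    (cost : ℝ) ≤ 30000 * ((m : ℝ) ^ 2 * (n + 1 : ℕ) * Real.log (n + 1 : ℕ) +
      ((m : ℝ) ^ 3 * (n + 1 : ℕ) + (m : ℝ) * ((n + 1 : ℕ) : ℝ) ^ 2) *
        Real.log |goffin A|⁻¹) := by
  have hD := hs.dvCount_le h hT
  have hm : (1 : ℝ) ≤ m := by exact_mod_cast h.m_pos
  have hn : (2 : ℝ) ≤ (n + 1 : ℕ) := by exact_mod_cast h.two_le_n
  have hρ := h.abs_goffin_pos
  have hlog2 : (1 / 2 : ℝ) ≤ Real.log 2 := by linarith [Real.log_two_gt_d9]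
  have hlog : 1 / 2 ≤ Real.log (n + 1 : ℕ) := hlog2.trans (Real.log_le_log (by norm_num) hn)
  have hℓ : 0 ≤ Real.log |goffin A|⁻¹ :=
    Real.log_nonneg ((one_le_inv₀ hρ).2 h.abs_goffin_le_one)
  have hcost' : (cost : ℝ) ≤ 30 * (m : ℝ) ^ 2 * (n + 1 : ℕ) + (21 * (n + 1 : ℕ) * dvCount s T +
      10 * m * (n + 1 : ℕ) * F + (27 * m * (n + 1 : ℕ) + 2 * ((n + 1 : ℕ) : ℝ) ^ 2) * R +
      2 * (n + 1 : ℕ)) := by exact_mod_cast hcost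
  have hF' : (F : ℝ) ≤ (n + 1 : ℕ) := by exact_mod_cast hF
  have hFT' : (F : ℝ) ≤ T := by exact_mod_cast hFT
  have hfast : 1 / 2 ≤ |goffin A| → (T : ℝ) ≤ 18 * Real.log (n + 1 : ℕ) :=
    hs.halt_le_of_half_le h hT
  have hslow : |goffin A| < 1 / 2 → 1 / 2 ≤ Real.log |goffin A|⁻¹ := fun hlt =>
    hlog2.trans (Real.log_le_log (by norm_num) ((le_inv_comm₀ (by norm_num) hρ).2 (by linarith)))
  generalize Real.log |goffin A|⁻¹ = ℓ at *
  generalize ((n + 1 : ℕ) : ℝ) = N at *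
  generalize Real.log N = lN at *
  generalize (m : ℝ) = M at *
  generalize (dvCount s T : ℝ) = D at *
  have hM2 : 1 ≤ M ^ 2 := one_le_pow₀ hm
  have hMM : M ≤ M ^ 2 := by nlinarith
  have hMM3 : M ^ 2 ≤ M ^ 3 := pow_le_pow_right₀ hm (by norm_num)
  have hN0 : 0 ≤ N := by linarith
  have t1 : 30 * M ^ 2 * N ≤ 60 * (M ^ 2 * N * lN) := by
    have := mul_le_mul_of_nonneg_left hlog (show 0 ≤ 60 * (M ^ 2 * N) by positivity)
    linarith
  have t2 : 21 * N * D ≤ 5124 * (M ^ 2 * N * lN) + 20328 * (M ^ 3 * N * ℓ) := by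
    have := mul_le_mul_of_nonneg_left hD (show 0 ≤ 21 * N by positivity)
    linarith
  have t3 : (27 * M * N + 2 * N ^ 2) * R ≤ 81 * (M ^ 3 * N * ℓ) + 6 * (M * N ^ 2 * ℓ) := by
    have h1 := mul_le_mul_of_nonneg_left hR (show 0 ≤ 27 * M * N + 2 * N ^ 2 by positivity)
    have h2 := mul_le_mul_of_nonneg_right hMM3 (show 0 ≤ 81 * (N * ℓ) by positivity)
    linarith
  have t4 : 2 * N ≤ 4 * (M ^ 2 * N * lN) := by
    have h1 := mul_le_mul_of_nonneg_right hM2 (show 0 ≤ 2 * N by positivity)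
    linarith
  -- The first uses are counted by `n` when |ρ| < 1/2, where the logarithm of |ρ|⁻¹ is at least 1/2,
  -- and otherwise by the O(log n) passes.
  have t5 : 10 * M * N * F ≤ 180 * (M ^ 2 * N * lN) + 20 * (M * N ^ 2 * ℓ) := by
    have hp1 : 0 ≤ M ^ 2 * N * lN := by positivity
    have hp2 : 0 ≤ M * N ^ 2 * ℓ := by positivity
    rcases lt_or_ge |goffin A| (1 / 2) with hlt | hge
    · have h1 := mul_le_mul_of_nonneg_left hF' (show 0 ≤ 10 * M * N by positivity)
      have h2 := mul_le_mul_of_nonneg_left (hslow hlt) (show 0 ≤ 20 * M * N ^ 2 by positivity)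
      linarith
    · have h1 := mul_le_mul_of_nonneg_left (hFT'.trans (hfast hge))
        (show 0 ≤ 10 * M * N by positivity)
      have h2 := mul_le_mul_of_nonneg_right hMM (show 0 ≤ 180 * (N * lN) by positivity)
      linarith
  have hp1 : 0 ≤ M ^ 2 * N * lN := by positivity
  have hp2 : 0 ≤ M * N ^ 2 * ℓ := by positivity
  have hp3 : 0 ≤ M ^ 3 * N * ℓ := by positivity
  linarith

end KernelAlg
end

theorem theorem2p4 :
    -- the constant of the O-notation is absolute
    ∃ C : ℝ, 0 < C ∧ ∀ (m n : ℕ) (A : Matrix (Fin m) (Fin n) ℝ),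
      (∀ j, ‖KernelAlg.col A j‖ = 1) → KernelAlg.goffin A < 0 →
      -- every execution of the algorithm, whatever the tie-breaking, finds a solution within
      -- the stated number of DV updates
      (∀ s : ℕ → KernelAlg.KState m n, KernelAlg.IsExecution A s →
        ∃ T : ℕ, KernelAlg.HaltsAt A s T ∧
          KernelAlg.mulVecL A (KernelAlg.kernelProj A (s T).x) = 0 ∧
          (∀ j, 0 < KernelAlg.kernelProj A (s T).x j) ∧
          (KernelAlg.dvCount s T : ℝ) ≤
            C * ((m : ℝ) ^ 2 * Real.log n + (m : ℝ) ^ 3 * Real.log |KernelAlg.goffin A|⁻¹)) ∧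
      -- the implementation carries out an execution of the algorithm, returns its output, and
      -- uses the stated number of arithmetic operations
      (∃ s : ℕ → KernelAlg.KState m n, KernelAlg.IsExecution A s ∧
        ∃ T : ℕ, KernelAlg.HaltsAt A s T ∧
          ∃ (w : KernelAlg.Prog.Work ℝ m n) (cost : ℕ),
            KernelAlg.implementation (fun i j => A i j) (T + 1) = some (w, cost) ∧
            (∀ j, w.xbar j = KernelAlg.kernelProj A (s T).x j) ∧
            (∀ j, w.x j = (s T).x j) ∧
            (∀ i j, w.A i j = (s T).A i j) ∧
            (cost : ℝ) ≤
              C * ((m : ℝ) ^ 2 * n * Real.log n +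
                ((m : ℝ) ^ 3 * n + (m : ℝ) * (n : ℝ) ^ 2) * Real.log |KernelAlg.goffin A|⁻¹)) := by
  refine ⟨30000, by norm_num, fun m n A hcol hρ => ?_⟩
  have h : KernelAlg.IsInput A := ⟨hcol, hρ⟩
  have hn := h.two_le_n
  constructor
  · intro s hs
    obtain ⟨T, hT⟩ := hs.exists_haltsAt h
    refine ⟨T, hT, LinearMap.mem_ker.1 (Submodule.starProjection_apply_mem
      (LinearMap.ker (KernelAlg.mulVecL A)) _), hT.1, (hs.dvCount_le h hT).trans ?_⟩
    have hℓ : 0 ≤ Real.log |KernelAlg.goffin A|⁻¹ :=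
      Real.log_nonneg ((one_le_inv₀ h.abs_goffin_pos).2 h.abs_goffin_le_one)
    have hlog : 0 ≤ Real.log n := Real.log_natCast_nonneg n
    have h1 : 0 ≤ (m : ℝ) ^ 2 * Real.log n := by positivity
    have h2 : 0 ≤ (m : ℝ) ^ 3 * Real.log |KernelAlg.goffin A|⁻¹ := by positivity
    linarith
  · obtain ⟨n, rfl⟩ : ∃ k, n = k + 1 := ⟨n - 1, by omega⟩
    obtain ⟨s, w, hs, hw0, hw, hpass⟩ := KernelAlg.exists_simulation h
    obtain ⟨T, hT⟩ := hs.exists_haltsAt h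
    obtain ⟨R, hR, hinv⟩ := hs.exists_inv h T hT.2
    obtain ⟨hrun, hlast⟩ := KernelAlg.loopBody_of_terminal (hw T) hT.1
    -- The exit test is evaluated once more than there are passes, hence the bound `T + 1`.
    have hwhile := KernelAlg.whileRun_eq KernelAlg.Prog.loopBody (w T) T w
      (fun t ht => (hpass t (hT.2 t ht)).run_eq) hrun
    have h0 : KernelAlg.cached (w 0) = 0 := by rw [hw0, KernelAlg.cached_initWork]
    obtain ⟨hF, hsum⟩ := KernelAlg.sum_cost_le h0 hpass T hT.2 R hR
    have hinit := KernelAlg.initWork_snd_le h.m_pos n.succ_pos fun i j => A i j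
    refine ⟨s, hs, T, hT, w T, _, ?_, fun j => congrFun (hw T).xbar_eq j,
      fun j => congrFun (hw T).x_eq j, (hw T).A_eq,
      KernelAlg.implementation_cost_le h hs hT (hinv.rescale_count_le h)
        (KernelAlg.cached_le (w T)) (hF.trans (by omega))
        (add_le_add hinit (add_le_add hsum hlast))⟩
    rw [KernelAlg.implementation, ← hw0, hwhile]
    rfl
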